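/- For every positive integer $n \equiv 0 \pmod 4$, the complete graph $K_n$ has a quadrangular embedding in some nonorientable surface. Here a surface is a compact topological $2$-manifold without boundary, and it is nonorientable if it contains a Möbius band; an embedding of a graph in a surface represents vertices by distinct points and edges by simple arcs joining their end vertices, the arcs being disjoint except at common end vertices; the faces are the connected components of the complement of the embedded graph; and the embedding is quadrangular if every face is homeomorphic to an open disk and is bounded by a $4$-cycle of the graph, that is, some continuous injective map of the closed disk into the surface maps the open disk onto the face and the boundary circle onto the $4$-cycle. -/

import Mathlib

/-- The Euclidean plane. -/
abbrev Plane : Type := EuclideanSpace ℝ (Fin 2)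

/-- A surface: a compact topological 2-manifold without boundary. Second countability is
automatic, since a compact locally Euclidean space is covered by finitely many charts. -/
structure IsSurface (X : Type*) [TopologicalSpace X] : Prop where
  t2 : T2Space X
  compact : CompactSpace X
  charts : Nonempty (ChartedSpace Plane X)

/-- The gluing `(0, t) ∼ (1, 1 - t)` of two opposite sides of the square `[0,1] × [0,1]`. -/
def MoebiusGlue (p q : unitInterval × unitInterval) : Prop :=
  p.1 = 0 ∧ q.1 = 1 ∧ q.2 = unitInterval.symm p.2

/-- The (closed) Möbius band: the quotient of the square by the equivalence relation generated
by `(0, t) ∼ (1, 1 - t)`, with the quotient topology. -/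
def MoebiusBand : Type := Quot MoebiusGlue

instance : TopologicalSpace MoebiusBand :=
  inferInstanceAs (TopologicalSpace (Quot MoebiusGlue))

/-- A surface is nonorientable if it contains a Möbius band. -/
def IsNonorientable (X : Type*) [TopologicalSpace X] : Prop :=
  ∃ f : MoebiusBand → X, Topology.IsEmbedding f

/-- A drawing without crossings of a (finite) simple graph in a topological space: vertices are
distinct points, and every edge `uv` is a simple arc joining the points `u` and `v`
(`arc h.symm` is `arc h` traversed backwards), such that the interior of an arc meets
neither a vertex nor another arc. -/
structure GraphEmbedding {V : Type*} (G : SimpleGraph V) (X : Type*) [TopologicalSpace X] where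
  vert : V → X
  arc : ∀ {u v : V}, G.Adj u v → Path (vert u) (vert v)
  vert_injective : Function.Injective vert
  arc_symm : ∀ {u v : V} (h : G.Adj u v) (t : unitInterval),
    arc h.symm t = arc h (unitInterval.symm t)
  arc_injective : ∀ {u v : V} (h : G.Adj u v), Function.Injective (arc h)
  arc_ne_vert : ∀ {u v : V} (h : G.Adj u v) (t : unitInterval), t ∈ Set.Ioo 0 1 →
    ∀ w : V, arc h t ≠ vert w
  arc_disjoint : ∀ {u v u' v' : V} (h : G.Adj u v) (h' : G.Adj u' v') (s t : unitInterval),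
    s ∈ Set.Ioo 0 1 → t ∈ Set.Ioo 0 1 → arc h s = arc h' t → s(u, v) = s(u', v')

namespace GraphEmbedding

variable {V : Type*} {G : SimpleGraph V} {X : Type*} [TopologicalSpace X]

/-- The set of points of `X` on the (closed) edge `e`. -/
def edgeCarrier (Φ : GraphEmbedding G X) (e : Sym2 V) : Set X :=
  {x | ∃ (u v : V) (h : G.Adj u v), s(u, v) = e ∧ x ∈ Set.range (Φ.arc h)}

/-- The set of points of `X` on the embedded graph. -/
def carrier (Φ : GraphEmbedding G X) : Set X :=
  Set.range Φ.vert ∪ ⋃ e : Sym2 V, Φ.edgeCarrier e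

/-- The set of points of `X` on the edges of a walk. -/
def walkCarrier (Φ : GraphEmbedding G X) {u v : V} (c : G.Walk u v) : Set X :=
  {x | ∃ e ∈ c.edges, x ∈ Φ.edgeCarrier e}

/-- The faces: the connected components of the complement of the embedded graph. -/
def IsFace (Φ : GraphEmbedding G X) (F : Set X) : Prop :=
  ∃ x ∈ Φ.carrierᶜ, F = connectedComponentIn Φ.carrierᶜ x

/-- An embedding is cellular if every face is homeomorphic to an open disk. -/
def IsCellular (Φ : GraphEmbedding G X) : Prop :=
  ∀ F : Set X, Φ.IsFace F → Nonempty (F ≃ₜ Metric.ball (0 : Plane) 1)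

/-- The face `F` is bounded by the cycle `c`: some continuous injective map of the closed unit
disk takes the open disk onto `F` and the unit circle onto the points of `c`. (Injectivity on
the circle says that the boundary of `F` runs exactly once around `c`.) -/
def IsBoundedBy (Φ : GraphEmbedding G X) (F : Set X) {v : V} (c : G.Walk v v) : Prop :=
  ∃ φ : Plane → X, ContinuousOn φ (Metric.closedBall 0 1) ∧
    Set.InjOn φ (Metric.closedBall 0 1) ∧
    φ '' Metric.ball 0 1 = F ∧ φ '' Metric.sphere 0 1 = Φ.walkCarrier c

/-- An embedding is quadrangular if it is cellular and every face is bounded by a 4-cycle. -/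
def IsQuadrangular (Φ : GraphEmbedding G X) : Prop :=
  Φ.IsCellular ∧ ∀ F : Set X, Φ.IsFace F →
    ∃ (v : V) (c : G.Walk v v), c.IsCycle ∧ c.length = 4 ∧ Φ.IsBoundedBy F c

end GraphEmbedding

/-! Write n = 4k + 4 and take as vertices the residues mod 4k + 3 and one further vertex ∞ (`none`).
The faces are the translates of k + 1 quadrangles y, y + 2k + 2 − i, y + 1, y + i + 1 with 0 ≤ i ≤
k, where ∞ replaces y + 1 if i = 0. Up to sign, the sides between residues have differences 2k + 2 −
i, 2k + 1 − i, i, i + 1 (for i = 0 only the first and the last), so each of 1, …, 2k + 1 occurs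
twice, and each residue is joined to ∞ by two sides. Hence every edge of the complete graph is a
side of two quadrangles. It remains to see that the quadrangles at each vertex form a single cycle:
`isRotation_some`, `isRotation_none`.

The quadrangles are glued inside a simplex, by coning each from a centre. All links in the resulting
complex are cycles, and the star of a vertex is the cone over its link, that is, a disk
(`IsCyclicLink.exists_isEmbedding_closedBall`). At every vertex this gives a chart
(`isSurface_realization`); at a centre it gives the face with its bounding 4-cycle
(`isBoundedBy_openFace`).

For nonorientability, the quadrangles with i = k have two opposite sides of difference k + 1. If k >
0, their 4k + 3 translates form a closed strip across these sides. Passing one quadrangle exchanges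
the roles of the two ends of the side, and 4k + 3 is odd, so the strip closes with a twist and
contains a Möbius band (`IsTwistedStrip.isNonorientable`). For k = 0 two quadrangles of K₄ form such
a strip. -/

open Topology

/-! ### Embeddings of compact quotients, and polar coordinates on the disk -/

/-- If a quotient map from a compact space and a continuous map to a Hausdorff space have the same
fibres, then the latter descends to an embedding. -/
theorem exists_isEmbedding_of_fibres_eq {A B X : Type*} [TopologicalSpace A] [TopologicalSpace B]
    [TopologicalSpace X] [CompactSpace A] [T2Space X] {p : A → B} (hp : IsQuotientMap p)
    {g : A → X} (hg : Continuous g) (h : ∀ a b, p a = p b ↔ g a = g b) :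
    ∃ φ : B → X, IsEmbedding φ ∧ ∀ a, φ (p a) = g a := by
  have key : ∀ a, g (Function.surjInv hp.surjective (p a)) = g a := fun a =>
    (h _ _).1 (Function.surjInv_eq hp.surjective (p a))
  let φ : B → X := fun b => g (Function.surjInv hp.surjective b)
  have hφ : Continuous φ := by
    rw [hp.continuous_iff]
    exact hg.congr fun a => (key a).symm
  have : CompactSpace B := ⟨by
    rw [← hp.surjective.range_eq]
    exact isCompact_range hp.continuous⟩
  refine ⟨φ, (hφ.isClosedEmbedding ?_).isEmbedding, key⟩
  intro b b' hbb
  have := (h _ _).2 hbb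
  rwa [Function.surjInv_eq hp.surjective, Function.surjInv_eq hp.surjective] at this

/-- Polar coordinates on the closed disk, the circle being divided into `d` arcs. -/
noncomputable def polar (d : ℕ) (a : Fin d × unitInterval × unitInterval) : Plane :=
  Complex.orthonormalBasisOneI.repr
    (((a.2.1 : ℝ) : ℂ) * Complex.exp ((2 * Real.pi * ((a.1 + a.2.2) / d) : ℝ) * Complex.I))

theorem norm_polar {d : ℕ} (a : Fin d × unitInterval × unitInterval) : ‖polar d a‖ = a.2.1 := by
  rw [polar, LinearIsometryEquiv.norm_map, norm_mul, Complex.norm_exp_ofReal_mul_I, mul_one,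
    Complex.norm_real, Real.norm_of_nonneg a.2.1.2.1]

theorem continuous_polar (d : ℕ) : Continuous (polar d) := by
  unfold polar
  refine (LinearIsometryEquiv.continuous _).comp ?_
  have h : Continuous fun a : Fin d × unitInterval × unitInterval => ((a.1 : ℕ) : ℝ) :=
    (continuous_of_discreteTopology (f := fun j : Fin d => ((j : ℕ) : ℝ))).comp continuous_fst
  fun_prop

/-- The angular position j + s lies in [0, d], so equal angles differ by at most one full turn d.
The condition is phrased exactly as in `IsCyclicLink.edgePt_eq_iff`, so that the disk and the cone
over a cycle are visibly the same quotient. -/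
theorem polar_eq_iff {d : ℕ} (a b : Fin d × unitInterval × unitInterval) :
    polar d a = polar d b ↔ (a.2.1 : ℝ) = b.2.1 ∧ ((a.2.1 : ℝ) = 0 ∨
      ((a.1 : ℝ) + a.2.2 = b.1 + b.2.2 ∨ (a.1 : ℝ) + a.2.2 = b.1 + b.2.2 + d ∨
        (b.1 : ℝ) + b.2.2 = a.1 + a.2.2 + d)) := by
  have hd : 0 < d := a.1.pos
  have hd' : (0 : ℝ) < d := by exact_mod_cast hd
  have hb : ∀ c : Fin d × unitInterval × unitInterval,
      (0 : ℝ) ≤ c.1 + c.2.2 ∧ (c.1 : ℝ) + c.2.2 ≤ d := by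
    intro c
    have h1 : ((c.1 : ℕ) : ℝ) + 1 ≤ d := by exact_mod_cast c.1.2
    have h2 := c.2.2.2
    refine ⟨add_nonneg (Nat.cast_nonneg _) h2.1, by linarith [h2.2]⟩
  have exp_iff : Complex.exp ((2 * Real.pi * ((a.1 + a.2.2) / d) : ℝ) * Complex.I) =
      Complex.exp ((2 * Real.pi * ((b.1 + b.2.2) / d) : ℝ) * Complex.I) ↔
      ((a.1 : ℝ) + a.2.2 = b.1 + b.2.2 ∨ (a.1 : ℝ) + a.2.2 = b.1 + b.2.2 + d ∨
        (b.1 : ℝ) + b.2.2 = a.1 + a.2.2 + d) := by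
    have aux : ∀ (x y : ℝ) (m : ℤ),
        ((2 * Real.pi * (x / d) : ℝ) : ℂ) * Complex.I =
          (2 * Real.pi * (y / d) : ℝ) * Complex.I + m * (2 * Real.pi * Complex.I) ↔
        x = y + m * d := by
      intro x y m
      have hpi := Real.pi_pos
      have e : ((2 * Real.pi * (y / d) : ℝ) : ℂ) * Complex.I + m * (2 * Real.pi * Complex.I) =
          ((2 * Real.pi * ((y + m * d) / d) : ℝ) : ℂ) * Complex.I := by
        have : (d : ℂ) ≠ 0 := by exact_mod_cast hd.ne'
        push_cast
        field_simp
      rw [e, mul_left_inj' Complex.I_ne_zero, Complex.ofReal_inj, mul_right_inj' (by positivity),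
        div_left_inj' hd'.ne']
    rw [Complex.exp_eq_exp_iff_exists_int]
    simp only [aux]
    constructor
    · rintro ⟨m, hm⟩
      have h1 := hb a
      have h2 := hb b
      have hm1 : (m : ℝ) ≤ 1 := by
        by_contra hc
        push Not at hc
        nlinarith
      have hm2 : (-1 : ℝ) ≤ m := by
        by_contra hc
        push Not at hc
        nlinarith
      have hm1' : m ≤ 1 := by exact_mod_cast hm1
      have hm2' : -1 ≤ m := by exact_mod_cast hm2
      interval_cases m
      · right; right; push_cast at hm; linarith
      · left; push_cast at hm; linarith
      · right; left; push_cast at hm; linarith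
    · rintro (h | h | h)
      · exact ⟨0, by push_cast; linarith⟩
      · exact ⟨1, by push_cast; linarith⟩
      · exact ⟨-1, by push_cast; linarith⟩
  constructor
  · intro h
    have hr : (a.2.1 : ℝ) = b.2.1 := by rw [← norm_polar a, h, norm_polar b]
    refine ⟨hr, ?_⟩
    by_cases h0 : (a.2.1 : ℝ) = 0
    · exact Or.inl h0
    · right
      unfold polar at h
      rw [LinearIsometryEquiv.map_eq_iff, ← hr, mul_right_inj' (by exact_mod_cast h0)] at h
      exact exp_iff.1 h
  · rintro ⟨hr, h0 | h⟩
    · unfold polar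
      rw [← hr, h0]
      simp
    · unfold polar
      rw [exp_iff.2 h, hr]

theorem exists_polar_eq {d : ℕ} (hd : 0 < d) {z : Plane} (hz : ‖z‖ ≤ 1) :
    ∃ a, polar d a = z := by
  set w : ℂ := Complex.orthonormalBasisOneI.repr.symm z with hw
  have hwn : ‖w‖ = ‖z‖ := LinearIsometryEquiv.norm_map _ _
  have hd' : (0 : ℝ) < d := by exact_mod_cast hd
  -- The principal argument may be negative; the fractional part turns it into a number of turns in
  -- [0, 1), so that the floor of d * t is a valid arc index.
  set t : ℝ := Int.fract (w.arg / (2 * Real.pi)) with ht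
  have ht0 : 0 ≤ d * t := mul_nonneg hd'.le (Int.fract_nonneg _)
  have ht1 : d * t < d := by nlinarith [Int.fract_lt_one (w.arg / (2 * Real.pi))]
  have hfl : ⌊d * t⌋₊ < d := (Nat.floor_lt ht0).2 ht1
  refine ⟨(⟨⌊d * t⌋₊, hfl⟩, ⟨‖z‖, norm_nonneg _, hz⟩, ⟨d * t - ⌊d * t⌋₊, ?_, ?_⟩), ?_⟩
  · linarith [Nat.floor_le ht0]
  · linarith [Nat.lt_floor_add_one (d * t)]
  · refine Eq.trans ?_ (LinearIsometryEquiv.apply_symm_apply Complex.orthonormalBasisOneI.repr z)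
    unfold polar
    congr 1
    rw [← hw]
    simp only [add_sub_cancel]
    rw [mul_div_cancel_left₀ _ hd'.ne', ← hwn]
    conv_rhs => rw [← Complex.norm_mul_exp_arg_mul_I w]
    congr 1
    rw [Complex.exp_eq_exp_iff_exists_int]
    refine ⟨-⌊w.arg / (2 * Real.pi)⌋, ?_⟩
    rw [ht, Int.fract]
    have : (Real.pi : ℂ) ≠ 0 := by exact_mod_cast Real.pi_ne_zero
    push_cast
    field_simp
    ring

/-! ### Simplicial complexes in barycentric coordinates -/

/-- The realization of the simplicial complex on the vertex set `W` whose facets are the members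
of `K`, in barycentric coordinates. -/
def realization {W : Type*} [Fintype W] (K : Set (Set W)) : Set (W → ℝ) :=
  {x | x ∈ stdSimplex ℝ W ∧ ∃ T ∈ K, Function.support x ⊆ T}

theorem isCompact_realization {W : Type*} [Fintype W] (K : Set (Set W)) :
    IsCompact (realization K) := by
  have : realization K = stdSimplex ℝ W ∩ ⋃ T ∈ K, ⋂ w ∈ Tᶜ, {x : W → ℝ | x w = 0} := by
    ext x
    simp only [realization, Set.mem_ofPred_eq, Set.mem_inter_iff, Set.mem_iUnion, Set.mem_iInter,
      exists_prop, Function.support_subset_iff', Set.mem_compl_iff]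
  rw [this]
  refine (isCompact_stdSimplex ℝ W).inter_right ?_
  refine Set.Finite.isClosed_biUnion (Set.toFinite K) fun T _ => ?_
  exact isClosed_biInter fun w _ => isClosed_eq (continuous_apply w) continuous_const

instance {W : Type*} [Fintype W] (K : Set (Set W)) : CompactSpace (realization K) :=
  isCompact_iff_compactSpace.1 (isCompact_realization K)

section points

variable {W : Type*} [DecidableEq W]

/-- The point dividing the segment from `a` to `b` in the ratio `s : 1 - s`. -/
def edgePt (a b : W) (s : ℝ) : W → ℝ := Pi.single a (1 - s) + Pi.single b s

/-- The point at parameter `r` on the segment from the vertex `a` to the point `y`. -/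
def conePt (a : W) (y : W → ℝ) (r : ℝ) : W → ℝ := Pi.single a (1 - r) + r • y

theorem edgePt_left {a b : W} (h : a ≠ b) (s : ℝ) : edgePt a b s a = 1 - s := by
  simp [edgePt, h]

theorem edgePt_right {a b : W} (h : a ≠ b) (s : ℝ) : edgePt a b s b = s := by
  simp [edgePt, h.symm]

theorem edgePt_of_ne {a b c : W} (h : c ≠ a) (h' : c ≠ b) (s : ℝ) : edgePt a b s c = 0 := by
  simp [edgePt, h, h']

theorem edgePt_zero (a b : W) : edgePt a b 0 = Pi.single a 1 := by simp [edgePt]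

theorem edgePt_one (a b : W) : edgePt a b 1 = Pi.single b 1 := by simp [edgePt]

theorem edgePt_symm (a b : W) (s : ℝ) : edgePt b a s = edgePt a b (1 - s) := by
  simp [edgePt, add_comm]

theorem continuous_edgePt (a b : W) : Continuous (edgePt a b) := by
  unfold edgePt
  have h1 : ∀ c : W, Continuous fun s : ℝ => (Pi.single c s : W → ℝ) := fun c =>
    continuous_single (A := fun _ : W => ℝ) c
  exact ((h1 a).comp (continuous_const.sub continuous_id)).add (h1 b)

theorem edgePt_mem_stdSimplex [Fintype W] (a b : W) {s : ℝ} (h0 : 0 ≤ s) (h1 : s ≤ 1) :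
    edgePt a b s ∈ stdSimplex ℝ W := by
  constructor
  · intro w
    have e1 : (0 : W → ℝ) ≤ Pi.single a (1 - s) := Pi.single_nonneg.2 (by linarith)
    have e2 : (0 : W → ℝ) ≤ Pi.single b s := Pi.single_nonneg.2 h0
    exact add_nonneg (e1 w) (e2 w)
  · simp [edgePt, Finset.sum_add_distrib]

theorem support_edgePt (a b : W) (s : ℝ) : Function.support (edgePt a b s) ⊆ {a, b} := by
  intro c hc
  by_contra h
  simp only [Set.mem_insert_iff, Set.mem_singleton_iff, not_or] at h
  exact hc (edgePt_of_ne h.1 h.2 s)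

theorem edgePt_injective {a b : W} (h : a ≠ b) : Function.Injective (edgePt a b) := by
  intro s t hst
  have := congrFun hst b
  rwa [edgePt_right h, edgePt_right h] at this

/-- Interior points of two edges can only agree if the edges agree. -/
theorem eq_of_edgePt_eq {a b c d : W} (hab : a ≠ b) {s t : ℝ} (hs0 : 0 < s)
    (hs1 : s < 1) (h : edgePt a b s = edgePt c d t) : s(a, b) = s(c, d) := by
  have ha : a ∈ ({c, d} : Set W) := support_edgePt c d t (by
    rw [Function.mem_support, ← h, edgePt_left hab]; linarith)
  have hb : b ∈ ({c, d} : Set W) := support_edgePt c d t (by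
    rw [Function.mem_support, ← h, edgePt_right hab]; linarith)
  simp only [Set.mem_insert_iff, Set.mem_singleton_iff] at ha hb
  rw [Sym2.eq_iff]
  rcases ha with rfl | rfl <;> rcases hb with rfl | rfl <;> simp_all

theorem eq_edgePt [Fintype W] {x : W → ℝ} (hx : x ∈ stdSimplex ℝ W) {a b : W} (hab : a ≠ b)
    (hs : Function.support x ⊆ {a, b}) : x = edgePt a b (x b) := by
  have h0 : ∀ c, c ≠ a → c ≠ b → x c = 0 := by
    intro c hca hcb
    by_contra hc
    have := hs hc
    simp [hca, hcb] at this
  have hsum : x a + x b = 1 := by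
    rw [← hx.2, ← Finset.sum_pair hab]
    refine Finset.sum_subset (Finset.subset_univ _) fun c _ hc => ?_
    simp only [Finset.mem_insert, Finset.mem_singleton, not_or] at hc
    exact h0 c hc.1 hc.2
  ext c
  by_cases hca : c = a
  · subst hca; rw [edgePt_left hab]; linarith
  · by_cases hcb : c = b
    · subst hcb; rw [edgePt_right hab]
    · rw [h0 c hca hcb, edgePt_of_ne hca hcb]

theorem continuous_conePt_edgePt (a b c : W) :
    Continuous fun p : ℝ × ℝ => conePt a (edgePt b c p.2) p.1 := by
  unfold conePt
  have h1 : Continuous fun s : ℝ => (Pi.single a s : W → ℝ) :=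
    continuous_single (A := fun _ : W => ℝ) a
  exact (h1.comp (continuous_const.sub continuous_fst)).add
    (continuous_fst.smul ((continuous_edgePt b c).comp continuous_snd))

theorem conePt_apex {a : W} {y : W → ℝ} (h : y a = 0) (r : ℝ) : conePt a y r a = 1 - r := by
  simp [conePt, h]

theorem conePt_of_ne {a c : W} (h : c ≠ a) (y : W → ℝ) (r : ℝ) :
    conePt a y r c = r * y c := by
  simp [conePt, h]

theorem conePt_mem_stdSimplex [Fintype W] (a : W) {y : W → ℝ} (hy : y ∈ stdSimplex ℝ W) {r : ℝ}
    (h0 : 0 ≤ r) (h1 : r ≤ 1) : conePt a y r ∈ stdSimplex ℝ W := by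
  have : conePt a y r = (1 - r) • Pi.single a 1 + r • y := by
    unfold conePt
    rw [← Pi.single_smul]
    simp
  rw [this]
  exact convex_stdSimplex ℝ W (single_mem_stdSimplex ℝ a) hy (by linarith) h0 (by ring)

theorem support_conePt (a : W) (y : W → ℝ) (r : ℝ) :
    Function.support (conePt a y r) ⊆ insert a (Function.support y) := by
  intro c hc
  by_cases h : c = a
  · exact Or.inl h
  · right
    rw [Function.mem_support, conePt_of_ne h] at hc
    exact right_ne_zero_of_mul hc

theorem conePt_eq_iff {a : W} {y z : W → ℝ} (hy : y a = 0) (hz : z a = 0) (r t : ℝ) :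
    conePt a y r = conePt a z t ↔ r = t ∧ (r = 0 ∨ y = z) := by
  constructor
  · intro h
    have hr : r = t := by
      have := congrFun h a
      rw [conePt_apex hy, conePt_apex hz] at this
      linarith
    refine ⟨hr, or_iff_not_imp_left.2 fun h0 => ?_⟩
    ext c
    by_cases hc : c = a
    · rw [hc, hy, hz]
    · have := congrFun h c
      rw [conePt_of_ne hc, conePt_of_ne hc, ← hr] at this
      exact mul_left_cancel₀ h0 this
  · rintro ⟨rfl, rfl | rfl⟩
    · simp [conePt]
    · rfl

theorem eq_conePt [Fintype W] {x : W → ℝ} (hx : x ∈ stdSimplex ℝ W) {a b c : W}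
    (hab : a ≠ b) (hac : a ≠ c) (hbc : b ≠ c) (hs : Function.support x ⊆ {a, b, c}) :
    ∃ r ∈ unitInterval, ∃ s ∈ unitInterval, x = conePt a (edgePt b c s) r := by
  have h0 : ∀ e, e ≠ a → e ≠ b → e ≠ c → x e = 0 := by
    intro e ha hb hc
    by_contra he
    have := hs he
    simp [ha, hb, hc] at this
  have hsum : x a + (x b + x c) = 1 := by
    rw [← hx.2, ← Finset.sum_pair hbc, ← Finset.sum_insert (by simp [hab, hac])]
    refine Finset.sum_subset (Finset.subset_univ _) fun e _ he => ?_
    simp only [Finset.mem_insert, Finset.mem_singleton, not_or] at he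
    exact h0 e he.1 he.2.1 he.2.2
  have ha := hx.1 a
  have hb := hx.1 b
  have hc := hx.1 c
  -- The radius is the total weight off the apex, and s is the share of c in it. At the apex the
  -- quotient is 0 / 0 = 0, where any s would serve.
  refine ⟨x b + x c, ⟨by linarith, by linarith⟩, x c / (x b + x c),
    ⟨by positivity, div_le_one_of_le₀ (by linarith) (by positivity)⟩, ?_⟩
  ext e
  by_cases hea : e = a
  · subst hea
    rw [conePt_apex (edgePt_of_ne hab hac _)]; linarith
  rw [conePt_of_ne hea]
  by_cases hbc0 : x b + x c = 0
  · have hb0 : x b = 0 := by linarith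
    have hc0 : x c = 0 := by linarith
    rw [hbc0, zero_mul]
    by_cases heb : e = b
    · rw [heb, hb0]
    by_cases hec : e = c
    · rw [hec, hc0]
    exact h0 e hea heb hec
  · by_cases heb : e = b
    · subst heb
      rw [edgePt_left hbc]; field_simp; ring
    by_cases hec : e = c
    · subst hec
      rw [edgePt_right hbc]; field_simp
    · rw [edgePt_of_ne heb hec, h0 e hea heb hec, mul_zero]

end points

/-! ### Stars of vertices with cyclic link -/

/-- The link of the vertex `w` in the complex with facets `K` is the cycle
`l 0, l 1, …, l d = l 0`. -/
structure IsCyclicLink {W : Type*} (K : Set (Set W)) (w : W) (d : ℕ) (l : ℕ → W) : Prop where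
  three_le : 3 ≤ d
  closed : l d = l 0
  injOn : Set.InjOn l (Set.Iio d)
  ne : ∀ j < d, l j ≠ w
  mem : ∀ j < d, ∃ T ∈ K, {w, l j, l (j + 1)} ⊆ T
  subset : ∀ T ∈ K, w ∈ T → ∃ j < d, T ⊆ {w, l j, l (j + 1)}

namespace IsCyclicLink

variable {W : Type*} {K : Set (Set W)} {w : W} {d : ℕ} {l : ℕ → W}

theorem eq_iff (h : IsCyclicLink K w d l) {i j : ℕ} (hi : i ≤ d) (hj : j ≤ d) :
    l i = l j ↔ i = j ∨ (i = 0 ∧ j = d) ∨ (i = d ∧ j = 0) := by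
  have h3 := h.three_le
  constructor
  · intro he
    rcases hi.eq_or_lt with rfl | hi' <;> rcases hj.eq_or_lt with rfl | hj'
    · simp
    · rw [h.closed] at he
      have := h.injOn (Set.mem_Iio.2 (by omega)) hj' he
      omega
    · rw [h.closed] at he
      have := h.injOn hi' (Set.mem_Iio.2 (by omega)) he
      omega
    · exact Or.inl (h.injOn hi' hj' he)
  · rintro (rfl | ⟨rfl, rfl⟩ | ⟨rfl, rfl⟩)
    · rfl
    · exact h.closed.symm
    · exact h.closed

theorem ne_succ (h : IsCyclicLink K w d l) {j : ℕ} (hj : j < d) : l j ≠ l (j + 1) := by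
  rw [Ne, h.eq_iff hj.le hj]
  have := h.three_le
  omega

theorem ne' (h : IsCyclicLink K w d l) {j : ℕ} (hj : j ≤ d) : l j ≠ w := by
  rcases hj.eq_or_lt with rfl | hj
  · rw [h.closed]
    exact h.ne 0 (by have := h.three_le; omega)
  · exact h.ne j hj

theorem edgePt_eq_iff [DecidableEq W] (h : IsCyclicLink K w d l) {i j : ℕ} (hi : i < d)
    (hj : j < d) {s t : ℝ} (hs : s ∈ unitInterval) (ht : t ∈ unitInterval) :
    edgePt (l i) (l (i + 1)) s = edgePt (l j) (l (j + 1)) t ↔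
      (i + s = j + t ∨ i + s = j + t + d ∨ j + t = i + s + d) := by
  have h3 := h.three_le
  constructor
  · intro he
    have vtx : ∀ i' ≤ d, ∀ j' ≤ d, l i' = l j' → ((i' : ℝ) = j' ∨ (i' : ℝ) = j' + d ∨
        (j' : ℝ) = i' + d) := by
      intro i' hi' j' hj' hl
      rcases (h.eq_iff hi' hj').1 hl with rfl | ⟨rfl, rfl⟩ | ⟨rfl, rfl⟩ <;> simp
    -- At an end of a side one coordinate is 1, which forces the other point to be an end of its
    -- side too; then only vertices of the cycle are compared.
    rcases hs.1.eq_or_lt with h0 | h0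
    · subst h0
      rw [edgePt_zero] at he
      have := congrFun he (l i)
      simp only [Pi.single_eq_same] at this
      by_cases h1 : l i = l j
      · rw [h1, edgePt_left (h.ne_succ hj)] at this
        obtain rfl : t = 0 := by linarith
        simpa using vtx i hi.le j hj.le h1
      · by_cases h2 : l i = l (j + 1)
        · rw [h2, edgePt_right (h.ne_succ hj)] at this
          subst this
          have := vtx i hi.le (j + 1) hj h2
          push_cast at this
          simpa using this
        · rw [edgePt_of_ne h1 h2] at this
          norm_num at this
    · rcases hs.2.eq_or_lt with h1 | h1
      · subst h1
        rw [edgePt_one] at he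
        have := congrFun he (l (i + 1))
        simp only [Pi.single_eq_same] at this
        by_cases h1 : l (i + 1) = l j
        · rw [h1, edgePt_left (h.ne_succ hj)] at this
          obtain rfl : t = 0 := by linarith
          have := vtx (i + 1) hi j hj.le h1
          push_cast at this
          simpa using this
        · by_cases h2 : l (i + 1) = l (j + 1)
          · rw [h2, edgePt_right (h.ne_succ hj)] at this
            subst this
            have := vtx (i + 1) hi (j + 1) hj h2
            push_cast at this
            simpa using this
          · rw [edgePt_of_ne h1 h2] at this
            norm_num at this
      -- An interior point determines its side as an unordered pair. As d ≥ 3, the pair determines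
      -- the index, and the reversed matching of ends is impossible.
      · have := eq_of_edgePt_eq (h.ne_succ hi) h0 h1 he
        rw [Sym2.eq_iff, h.eq_iff hi.le hj.le, h.eq_iff hi hj, h.eq_iff hi.le hj,
          h.eq_iff hi hj.le] at this
        have hij : i = j := by omega
        subst hij
        have := edgePt_injective (h.ne_succ hi) he
        simp [this]
  · intro he
    obtain ⟨hs0, hs1⟩ := hs
    obtain ⟨ht0, ht1⟩ := ht
    have hid : (i : ℝ) + 1 ≤ d := by exact_mod_cast hi
    have hjd : (j : ℝ) + 1 ≤ d := by exact_mod_cast hj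
    have hi0 : (0 : ℝ) ≤ i := Nat.cast_nonneg _
    have hj0 : (0 : ℝ) ≤ j := Nat.cast_nonneg _
    rcases he with he | he | he
    · rcases lt_trichotomy i j with hlt | rfl | hlt
      · have hle : (i : ℝ) + 1 ≤ j := by exact_mod_cast hlt
        obtain rfl : s = 1 := by linarith
        obtain rfl : t = 0 := by linarith
        have : i + 1 = j := by
          have : (i : ℝ) + 1 = j := by linarith
          exact_mod_cast this
        rw [edgePt_one, edgePt_zero, this]
      · obtain rfl : s = t := by linarith
        rfl
      · have hle : (j : ℝ) + 1 ≤ i := by exact_mod_cast hlt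
        obtain rfl : s = 0 := by linarith
        obtain rfl : t = 1 := by linarith
        have : j + 1 = i := by
          have : (j : ℝ) + 1 = i := by linarith
          exact_mod_cast this
        rw [edgePt_one, edgePt_zero, this]
    · obtain rfl : s = 1 := by linarith
      obtain rfl : t = 0 := by linarith
      have h1 : i + 1 = d := by
        have : (i : ℝ) + 1 = d := by linarith
        exact_mod_cast this
      have h2 : j = 0 := by
        have : (j : ℝ) = 0 := by linarith
        exact_mod_cast this
      rw [edgePt_one, edgePt_zero, h1, h2, h.closed]
    · obtain rfl : s = 0 := by linarith
      obtain rfl : t = 1 := by linarith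
      have h1 : j + 1 = d := by
        have : (j : ℝ) + 1 = d := by linarith
        exact_mod_cast this
      have h2 : i = 0 := by
        have : (i : ℝ) = 0 := by linarith
        exact_mod_cast this
      rw [edgePt_one, edgePt_zero, h1, h2, h.closed]

/-- The closed star of a vertex with cyclic link is a disk. -/
theorem exists_isEmbedding_closedBall [Fintype W] (h : IsCyclicLink K w d l) :
    ∃ φ : Metric.closedBall (0 : Plane) 1 → realization K, IsEmbedding φ ∧
      (∀ z, (φ z : W → ℝ) w = 1 - ‖(z : Plane)‖) ∧
      Set.range φ = {x : realization K |
        ∃ j < d, Function.support (x : W → ℝ) ⊆ {w, l j, l (j + 1)}} := by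
  classical
  have h3 := h.three_le
  let p : Fin d × unitInterval × unitInterval → Metric.closedBall (0 : Plane) 1 := fun a =>
    ⟨polar d a, by rw [mem_closedBall_zero_iff, norm_polar]; exact a.2.1.2.2⟩
  have hpc : Continuous p := (continuous_polar d).subtype_mk _
  have hps : Function.Surjective p := by
    rintro ⟨z, hz⟩
    obtain ⟨a, ha⟩ := exists_polar_eq (by omega : 0 < d) (mem_closedBall_zero_iff.1 hz)
    exact ⟨a, Subtype.ext ha⟩
  have hp : IsQuotientMap p := hpc.isClosedMap.isQuotientMap hpc hps
  have hsupp : ∀ a : Fin d × unitInterval × unitInterval,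
      Function.support (conePt w (edgePt (l a.1) (l (a.1 + 1)) a.2.2) a.2.1) ⊆
        {w, l a.1, l (a.1 + 1)} := fun a =>
    (support_conePt _ _ _).trans (Set.insert_subset_insert (support_edgePt _ _ _))
  let g : Fin d × unitInterval × unitInterval → realization K := fun a =>
    ⟨conePt w (edgePt (l a.1) (l (a.1 + 1)) a.2.2) a.2.1,
      conePt_mem_stdSimplex _ (edgePt_mem_stdSimplex _ _ a.2.2.2.1 a.2.2.2.2) a.2.1.2.1 a.2.1.2.2,
      (h.mem a.1 a.1.2).imp fun T hT => ⟨hT.1, (hsupp a).trans hT.2⟩⟩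
  have hgc : Continuous g := by
    refine Continuous.subtype_mk ?_ _
    refine continuous_prod_of_discrete_left.2 fun j => ?_
    exact (continuous_conePt_edgePt w (l j) (l (j + 1))).comp
      (continuous_subtype_val.prodMap continuous_subtype_val)
  have hw0 : ∀ (j : Fin d) (s : ℝ), edgePt (l j) (l (j + 1)) s w = 0 := fun j s =>
    edgePt_of_ne (h.ne' j.2.le).symm (h.ne' j.2).symm s
  -- Disk and star are both quotients of d squares (radius, position on the arc), with the same
  -- identifications.
  have hfib : ∀ a b, p a = p b ↔ g a = g b := by
    intro a b
    rw [Subtype.ext_iff, Subtype.ext_iff, polar_eq_iff, conePt_eq_iff (hw0 _ _) (hw0 _ _),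
      h.edgePt_eq_iff a.1.2 b.1.2 a.2.2.2 b.2.2.2]
  obtain ⟨φ, hφ, hφg⟩ := exists_isEmbedding_of_fibres_eq hp hgc hfib
  refine ⟨φ, hφ, ?_, ?_⟩
  · intro z
    obtain ⟨a, rfl⟩ := hps z
    rw [hφg]
    change conePt w _ _ w = 1 - ‖polar d a‖
    rw [conePt_apex (hw0 _ _), norm_polar]
  · ext x
    constructor
    · rintro ⟨z, rfl⟩
      obtain ⟨a, rfl⟩ := hps z
      rw [hφg]
      exact ⟨a.1, a.1.2, hsupp a⟩
    · rintro ⟨j, hj, hx⟩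
      obtain ⟨r, hr, s, hs, hx'⟩ := eq_conePt x.2.1 (h.ne' hj.le).symm (h.ne' hj).symm
        (h.ne_succ hj) hx
      exact ⟨p (⟨j, hj⟩, ⟨r, hr⟩, ⟨s, hs⟩), by rw [hφg]; exact Subtype.ext hx'.symm⟩

/-- The open star of a vertex with cyclic link is an open disk. -/
theorem exists_isOpenEmbedding_ball [Fintype W] (h : IsCyclicLink K w d l) :
    ∃ φ : Metric.ball (0 : Plane) 1 → realization K, IsOpenEmbedding φ ∧
      Set.range φ = {x : realization K | 0 < (x : W → ℝ) w} := by
  obtain ⟨φ, hφ, hw, hr⟩ := h.exists_isEmbedding_closedBall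
  let ι : Metric.ball (0 : Plane) 1 → Metric.closedBall (0 : Plane) 1 :=
    Set.inclusion Metric.ball_subset_closedBall
  have hrange : Set.range (φ ∘ ι) = {x : realization K | 0 < (x : W → ℝ) w} := by
    ext x
    constructor
    · rintro ⟨z, rfl⟩
      have := mem_ball_zero_iff.1 z.2
      simp only [Function.comp, Set.mem_ofPred_eq, hw]
      exact sub_pos.2 this
    · intro hx
      obtain ⟨T, hT, hxT⟩ := x.2.2
      obtain ⟨j, hj, hTj⟩ := h.subset T hT (hxT (ne_of_gt hx))
      have : x ∈ Set.range φ := by rw [hr]; exact ⟨j, hj, hxT.trans hTj⟩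
      obtain ⟨z, rfl⟩ := this
      have hx' : 0 < (φ z : W → ℝ) w := hx
      rw [hw] at hx'
      exact ⟨⟨z, mem_ball_zero_iff.2 (by linarith)⟩, rfl⟩
  refine ⟨φ ∘ ι, ⟨hφ.comp (.inclusion _), ?_⟩, hrange⟩
  rw [hrange]
  exact isOpen_lt continuous_const ((continuous_apply w).comp continuous_subtype_val)

end IsCyclicLink

/-- A finite simplicial complex all of whose vertex links are cycles is a surface. -/
theorem isSurface_realization {W : Type*} [Fintype W] {K : Set (Set W)}
    (h : ∀ w, ∃ d l, IsCyclicLink K w d l) : IsSurface (realization K) := by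
  refine ⟨inferInstance, inferInstance, ⟨?_⟩⟩
  have hne : Nonempty (Metric.ball (0 : Plane) 1) := ⟨⟨0, by simp⟩⟩
  have hex : ∀ w, ∃ e : OpenPartialHomeomorph (realization K) Plane,
      e.source = {x : realization K | 0 < (x : W → ℝ) w} := by
    intro w
    obtain ⟨d, l, hl⟩ := h w
    obtain ⟨φ, hφ, hr⟩ := hl.exists_isOpenEmbedding_ball
    refine ⟨(hφ.toOpenPartialHomeomorph φ).symm.trans
      (Metric.isOpen_ball.isOpenEmbedding_subtypeVal.toOpenPartialHomeomorph Subtype.val), ?_⟩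
    simp [hr]
  choose e he using hex
  -- The coordinates sum to 1, so one is positive: the open stars cover the realization.
  have hpos : ∀ x : realization K, ∃ w, 0 < (x : W → ℝ) w := by
    intro x
    by_contra! hc
    have : ∑ w, (x : W → ℝ) w ≤ 0 := Finset.sum_nonpos fun w _ => hc w
    rw [x.2.1.2] at this
    linarith
  choose c hc using hpos
  exact
    { atlas := Set.range e
      chartAt := fun x => e (c x)
      mem_chart_source := fun x => by rw [he]; exact hc x
      chart_mem_atlas := fun x => ⟨c x, rfl⟩ }

/-! ### Combinatorial quadrangulations and their surfaces -/

/-- The neighbours `u 0, u 1, …, u d = u 0` of the vertex `v` in cyclic order, where the quadrangle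
`φ j` has a corner at `v` between `u j` and `u (j + 1)`. -/
structure IsRotation {V F : Type*} (q : F → Fin 4 → V) (v : V) (d : ℕ) (u : ℕ → V) (φ : ℕ → F) :
    Prop where
  three_le : 3 ≤ d
  closed : u d = u 0
  injOn : Set.InjOn u (Set.Iio d)
  corner : ∀ j < d, ∃ c, q (φ j) c = v ∧
    s(q (φ j) (c + 1), q (φ j) (c + 3)) = s(u j, u (j + 1))
  exists_eq : ∀ f c, q f c = v → ∃ j < d, f = φ j

/-- A face has at most one corner at v, so it determines the pair of neighbours of v beside that
corner; with at least three neighbours in the cycle, this pair determines the index. -/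
theorem IsRotation.face_injOn {V F : Type*} {q : F → Fin 4 → V}
    (hq : ∀ f, Function.Injective (q f)) {v : V} {d : ℕ} {u : ℕ → V} {φ : ℕ → F} (h : IsRotation q v d u φ) : Set.InjOn φ (Set.Iio d) := by
  intro i hi j hj hij
  rw [Set.mem_Iio] at hi hj
  have h3 := h.three_le
  obtain ⟨c, hc, hc'⟩ := h.corner i hi
  obtain ⟨e, he, he'⟩ := h.corner j hj
  rw [← hij] at he he'
  obtain rfl : c = e := hq _ (hc.trans he.symm)
  rw [hc', Sym2.eq_iff] at he'
  have key : ∀ a ≤ d, ∀ b ≤ d, u a = u b → a = b ∨ (a = 0 ∧ b = d) ∨ (a = d ∧ b = 0) := by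
    intro a ha b hb hab
    rcases ha.eq_or_lt with rfl | ha' <;> rcases hb.eq_or_lt with rfl | hb'
    · simp
    · rw [h.closed] at hab
      have := h.injOn (Set.mem_Iio.2 (by omega)) hb' hab
      omega
    · rw [h.closed] at hab
      have := h.injOn ha' (Set.mem_Iio.2 (by omega)) hab
      omega
    · exact Or.inl (h.injOn ha' hb' hab)
  rcases he' with ⟨h1, h2⟩ | ⟨h1, h2⟩
  · have := key _ hi.le _ hj.le h1
    omega
  · have := key _ hi.le _ hj h1
    have := key _ hi _ hj.le h2
    omega

/-- A combinatorial quadrangular embedding of the complete graph on `V` with set of faces `F`. -/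
structure CompleteQuadrangulation (V F : Type*) where
  q : F → Fin 4 → V
  injective : ∀ f, Function.Injective (q f)
  exists_edge : ∀ u v, u ≠ v → ∃ f c, s(q f c, q f (c + 1)) = s(u, v)
  exists_rotation : ∀ v, ∃ d u φ, IsRotation q v d u φ

namespace CompleteQuadrangulation

variable {V F : Type*} (Q : CompleteQuadrangulation V F)

theorem ofNat_four_succ (j : ℕ) : Fin.ofNat 4 (j + 1) = Fin.ofNat 4 j + 1 := by
  ext
  simp [Fin.val_add]

/-- The triangles obtained by coning every face from its centre. -/
def facets : Set (Set (V ⊕ F)) :=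
  {T | ∃ f c, T = {Sum.inr f, Sum.inl (Q.q f c), Sum.inl (Q.q f (c + 1))}}

theorem isCyclicLink_face (f : F) :
    IsCyclicLink Q.facets (Sum.inr f) 4 (fun m => Sum.inl (Q.q f (Fin.ofNat 4 m))) where
  three_le := by norm_num
  closed := rfl
  injOn := by
    intro i hi j hj h
    have := Q.injective f (Sum.inl_injective h)
    rw [Set.mem_Iio] at hi hj
    interval_cases i <;> interval_cases j <;> first | rfl | exact absurd this (by decide)
  ne := by simp
  mem := fun j _ => ⟨_, ⟨f, Fin.ofNat 4 j, rfl⟩, by rw [ofNat_four_succ]⟩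
  subset := by
    rintro T ⟨f', c, rfl⟩ h
    obtain rfl : f = f' := by simpa using h
    exact ⟨c, c.2, by rw [ofNat_four_succ, Fin.ofNat_val_eq_self]⟩

theorem exists_isCyclicLink (w : V ⊕ F) : ∃ d l, IsCyclicLink Q.facets w d l := by
  rcases w with v | f
  swap
  · exact ⟨_, _, Q.isCyclicLink_face f⟩
  obtain ⟨d, u, φ, h⟩ := Q.exists_rotation v
  have h3 := h.three_le
  have hφ := h.face_injOn Q.injective
  have hfacet : ∀ f c, ({Sum.inr f, Sum.inl (Q.q f c), Sum.inl (Q.q f (c + 1))} : Set (V ⊕ F)) ∈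
      Q.facets := fun f c => ⟨f, c, rfl⟩
  have hsub : ∀ c : Fin 4, c + 3 + 1 = c := by
    intro c; fin_cases c <;> rfl
  have hside : ∀ j < d, ∀ i, i = j ∨ i = j + 1 →
      ∃ T ∈ Q.facets, ({Sum.inl v, Sum.inr (φ j), Sum.inl (u i)} : Set (V ⊕ F)) ⊆ T := by
    intro j hj i hi
    obtain ⟨c, hc, hu⟩ := h.corner j hj
    have hi' : u i = Q.q (φ j) (c + 1) ∨ u i = Q.q (φ j) (c + 3) := by
      rw [Sym2.eq_iff] at hu
      rcases hi with rfl | rfl <;> rcases hu with ⟨h1, h2⟩ | ⟨h1, h2⟩ <;> simp [h1, h2]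
    rcases hi' with hi' | hi'
    · refine ⟨_, hfacet (φ j) c, ?_⟩
      rw [hi', hc]
      intro x; simp only [Set.mem_insert_iff, Set.mem_singleton_iff]; tauto
    · refine ⟨_, hfacet (φ j) (c + 3), ?_⟩
      rw [hi', hsub, hc]
      intro x; simp only [Set.mem_insert_iff, Set.mem_singleton_iff]; tauto
  -- The link of v alternates between neighbours (even positions) and centres of the faces at v (odd
  -- positions).
  refine ⟨2 * d, fun m => if m % 2 = 0 then Sum.inl (u (m / 2)) else Sum.inr (φ (m / 2)), ?_⟩
  have even_l : ∀ j, (if (2 * j) % 2 = 0 then Sum.inl (u (2 * j / 2)) else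
      Sum.inr (φ (2 * j / 2)) : V ⊕ F) = Sum.inl (u j) := fun j => by
    rw [if_pos (by omega), show 2 * j / 2 = j by omega]
  have odd_l : ∀ j, (if (2 * j + 1) % 2 = 0 then Sum.inl (u ((2 * j + 1) / 2)) else
      Sum.inr (φ ((2 * j + 1) / 2)) : V ⊕ F) = Sum.inr (φ j) := fun j => by
    rw [if_neg (by omega), show (2 * j + 1) / 2 = j by omega]
  constructor
  · omega
  · simp [h.closed]
  · intro a ha b hb hab
    rw [Set.mem_Iio] at ha hb
    dsimp only at hab
    split_ifs at hab with h1 h2 h2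
    · have := h.injOn (Set.mem_Iio.2 (by omega)) (Set.mem_Iio.2 (by omega))
        (Sum.inl_injective hab)
      omega
    · have := hφ (Set.mem_Iio.2 (by omega)) (Set.mem_Iio.2 (by omega))
        (Sum.inr_injective hab)
      omega
  · intro m hm
    split_ifs with h1
    · intro he
      have he := Sum.inl_injective he
      obtain ⟨c, hc, hu⟩ := h.corner (m / 2) (by omega)
      rw [Sym2.eq_iff] at hu
      rcases hu with ⟨h1, h2⟩ | ⟨h1, h2⟩
      · have := Q.injective _ ((h1.trans he).trans hc.symm)
        revert this; fin_cases c <;> decide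
      · have := Q.injective _ ((h2.trans he).trans hc.symm)
        revert this; fin_cases c <;> decide
    · simp
  · intro m hm
    obtain ⟨j, rfl | rfl⟩ := Nat.even_or_odd' m
    · rw [even_l, odd_l]
      obtain ⟨T, hT, hs⟩ := hside j (by omega) j (Or.inl rfl)
      refine ⟨T, hT, subset_trans ?_ hs⟩
      intro x; simp only [Set.mem_insert_iff, Set.mem_singleton_iff]; tauto
    · rw [odd_l, show 2 * j + 1 + 1 = 2 * (j + 1) by ring, even_l]
      exact hside j (by omega) (j + 1) (Or.inr rfl)
  · rintro T ⟨f, c, rfl⟩ hv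
    -- Here b is the corner at v and c' an adjacent corner; a facet containing v arises with v at
    -- either end of its side, and both cases reduce to this.
    have main : ∀ b c', Q.q f b = v → (c' = b + 1 ∨ c' = b + 3) → ∃ m < 2 * d,
        ({Sum.inr f, Sum.inl v, Sum.inl (Q.q f c')} : Set (V ⊕ F)) ⊆ {Sum.inl v,
          if m % 2 = 0 then Sum.inl (u (m / 2)) else Sum.inr (φ (m / 2)),
          if (m + 1) % 2 = 0 then Sum.inl (u ((m + 1) / 2)) else Sum.inr (φ ((m + 1) / 2))} := by
      intro b c' hb hc'
      obtain ⟨j, hj, rfl⟩ := h.exists_eq f b hb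
      obtain ⟨e, he, hu⟩ := h.corner j hj
      obtain rfl : b = e := Q.injective _ (hb.trans he.symm)
      have : Q.q (φ j) c' = u j ∨ Q.q (φ j) c' = u (j + 1) := by
        rw [Sym2.eq_iff] at hu
        rcases hc' with rfl | rfl <;> rcases hu with ⟨h1, h2⟩ | ⟨h1, h2⟩ <;> simp [h1, h2]
      rcases this with h' | h'
      · refine ⟨2 * j, by omega, ?_⟩
        rw [even_l, odd_l, h']
        intro x; simp only [Set.mem_insert_iff, Set.mem_singleton_iff]; tauto
      · refine ⟨2 * j + 1, by omega, ?_⟩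
        rw [odd_l, show 2 * j + 1 + 1 = 2 * (j + 1) by ring, even_l, h']
        intro x; simp only [Set.mem_insert_iff, Set.mem_singleton_iff]; tauto
    simp only [Set.mem_insert_iff, Set.mem_singleton_iff, reduceCtorEq, false_or,
      Sum.inl.injEq] at hv
    rcases hv with rfl | rfl
    · exact main c (c + 1) rfl (Or.inl rfl)
    · obtain ⟨m, hm, hs⟩ := main (c + 1) c rfl (Or.inr (by fin_cases c <;> rfl))
      refine ⟨m, hm, subset_trans ?_ hs⟩
      intro x; simp only [Set.mem_insert_iff, Set.mem_singleton_iff]; tauto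

/-! ### The graph drawn on the surface, and its faces -/

/-- The boundary of the face `f`. -/
def boundary (f : F) : (SimpleGraph.completeGraph V).Walk (Q.q f 0) (Q.q f 0) :=
  .cons ((Q.injective f).ne (by decide) : Q.q f 0 ≠ Q.q f 1) <|
  .cons ((Q.injective f).ne (by decide) : Q.q f 1 ≠ Q.q f 2) <|
  .cons ((Q.injective f).ne (by decide) : Q.q f 2 ≠ Q.q f 3) <|
  .cons ((Q.injective f).ne (by decide) : Q.q f 3 ≠ Q.q f 0) .nil

theorem isCycle_boundary (f : F) : (Q.boundary f).IsCycle := by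
  have h : ∀ i j, Q.q f i = Q.q f j ↔ i = j := fun i j => (Q.injective f).eq_iff
  rw [boundary, SimpleGraph.Walk.cons_isCycle_iff]
  constructor
  · simp [h]
  · simp [h]

variable [Fintype V] [Fintype F]

/-- The surface obtained by gluing the quadrangles along their sides. -/
abbrev Surface : Type _ := realization Q.facets

theorem isSurface : IsSurface Q.Surface := isSurface_realization Q.exists_isCyclicLink

/-- Each facet contains only one centre; hence distinct open faces are disjoint. -/
theorem eq_of_pos (x : Q.Surface) {f g : F} (hf : 0 < (x : V ⊕ F → ℝ) (Sum.inr f))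
    (hg : 0 < (x : V ⊕ F → ℝ) (Sum.inr g)) : f = g := by
  obtain ⟨T, ⟨f', c, rfl⟩, hs⟩ := x.2.2
  have h1 := hs hf.ne'
  have h2 := hs hg.ne'
  simp only [Set.mem_insert_iff, Set.mem_singleton_iff, reduceCtorEq, or_false,
    Sum.inr.injEq] at h1 h2
  rw [h1, h2]

/-- The open star of the centre of the face `f`. -/
def openFace (f : F) : Set Q.Surface := {x | 0 < (x : V ⊕ F → ℝ) (Sum.inr f)}

theorem isOpen_openFace (f : F) : IsOpen (Q.openFace f) :=
  isOpen_lt continuous_const ((continuous_apply _).comp continuous_subtype_val)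

theorem nonempty_homeomorph_openFace (f : F) :
    Nonempty (Q.openFace f ≃ₜ Metric.ball (0 : Plane) 1) := by
  obtain ⟨φ, hφ, hr⟩ := (Q.isCyclicLink_face f).exists_isOpenEmbedding_ball
  have : Q.openFace f = Set.range φ := hr.symm
  rw [this]
  exact ⟨hφ.isEmbedding.toHomeomorph.symm⟩

theorem isPreconnected_openFace (f : F) : IsPreconnected (Q.openFace f) := by
  obtain ⟨φ, hφ, hr⟩ := (Q.isCyclicLink_face f).exists_isOpenEmbedding_ball
  have : Q.openFace f = Set.range φ := hr.symm
  rw [this]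
  have : PreconnectedSpace (Metric.ball (0 : Plane) 1) :=
    isPreconnected_iff_preconnectedSpace.1 (convex_ball _ _).isPreconnected
  exact isPreconnected_range hφ.continuous

variable [DecidableEq V] [DecidableEq F]

theorem edgePt_mem {u v : V} (h : u ≠ v) {s : ℝ} (hs : s ∈ unitInterval) :
    edgePt (Sum.inl u) (Sum.inl v) s ∈ realization Q.facets := by
  refine ⟨edgePt_mem_stdSimplex _ _ hs.1 hs.2, ?_⟩
  obtain ⟨f, c, hfc⟩ := Q.exists_edge u v h
  refine ⟨_, ⟨f, c, rfl⟩, (support_edgePt _ _ _).trans ?_⟩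
  rw [Sym2.eq_iff] at hfc
  rcases hfc with ⟨h1, h2⟩ | ⟨h1, h2⟩ <;>
  · rw [h1, h2]
    intro x; simp only [Set.mem_insert_iff, Set.mem_singleton_iff]; tauto

theorem single_mem (v : V) : (Pi.single (Sum.inl v) 1 : V ⊕ F → ℝ) ∈ realization Q.facets := by
  obtain ⟨d, u, φ, h⟩ := Q.exists_rotation v
  obtain ⟨c, hc, -⟩ := h.corner 0 (by have := h.three_le; omega)
  rw [← edgePt_zero _ (Sum.inl (Q.q (φ 0) (c + 1))), ← hc]
  refine Q.edgePt_mem (fun h => ?_) ⟨le_rfl, zero_le_one⟩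
  have := Q.injective _ h
  revert this; fin_cases c <;> decide

/-- The complete graph drawn on the surface, with straight edges. -/
def embedding : GraphEmbedding (SimpleGraph.completeGraph V) Q.Surface where
  vert v := ⟨Pi.single (Sum.inl v) 1, Q.single_mem v⟩
  arc {u v} h :=
    { toFun := fun t => ⟨edgePt (Sum.inl u) (Sum.inl v) t, Q.edgePt_mem h.ne t.2⟩
      continuous_toFun := ((continuous_edgePt _ _).comp continuous_subtype_val).subtype_mk _
      source' := Subtype.ext (edgePt_zero _ _)
      target' := Subtype.ext (edgePt_one _ _) }
  vert_injective u v h := by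
    by_contra hne
    have := congrFun (Subtype.ext_iff.1 h) (Sum.inl v)
    simp [Ne.symm hne] at this
  arc_symm {u v} h t := Subtype.ext (by
    change edgePt _ _ (t : ℝ) = edgePt _ _ (1 - t : ℝ)
    rw [edgePt_symm])
  arc_injective {u v} h s t hst :=
    Subtype.ext (edgePt_injective (Sum.inl_injective.ne h.ne) (Subtype.ext_iff.1 hst))
  arc_ne_vert {u v} h t ht w he := by
    have he : edgePt (Sum.inl u) (Sum.inl v) (t : ℝ) = Pi.single (Sum.inl w) 1 :=
      Subtype.ext_iff.1 he
    have hne : (Sum.inl u : V ⊕ F) ≠ Sum.inl v := Sum.inl_injective.ne h.ne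
    have h0 : (0 : ℝ) < t := ht.1
    have h1 : (t : ℝ) < 1 := ht.2
    have e1 := congrFun he (Sum.inl u)
    have e2 := congrFun he (Sum.inl v)
    rw [edgePt_left hne, Pi.single_apply] at e1
    rw [edgePt_right hne, Pi.single_apply] at e2
    split_ifs at e1 e2 <;> linarith
  arc_disjoint {u v u' v'} h h' s t hs _ he := by
    have := eq_of_edgePt_eq (Sum.inl_injective.ne h.ne) (s := s) (t := t) hs.1 hs.2
      (Subtype.ext_iff.1 he)
    simpa [Sym2.eq_iff] using this

theorem mem_edgeCarrier {u v : V} (h : u ≠ v) (x : Q.Surface) :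
    x ∈ Q.embedding.edgeCarrier s(u, v) ↔
      Function.support (x : V ⊕ F → ℝ) ⊆ {Sum.inl u, Sum.inl v} := by
  constructor
  · rintro ⟨u', v', h', he, t, rfl⟩
    refine (support_edgePt _ _ _).trans ?_
    rw [Sym2.eq_iff] at he
    rcases he with ⟨rfl, rfl⟩ | ⟨rfl, rfl⟩
    · rfl
    · rw [Set.pair_comm]
  · intro hx
    have hne : (Sum.inl u : V ⊕ F) ≠ Sum.inl v := Sum.inl_injective.ne h
    refine ⟨u, v, h, rfl, ⟨(x : V ⊕ F → ℝ) (Sum.inl v), x.2.1.1 _, ?_⟩,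
      Subtype.ext (eq_edgePt x.2.1 hne hx).symm⟩
    exact (mem_Icc_of_mem_stdSimplex x.2.1 _).2

/-- A facet without its centre is a side of a quadrangle, so the points off all centres are those of
the drawn edges. -/
theorem mem_carrier (x : Q.Surface) :
    x ∈ Q.embedding.carrier ↔ ∀ f, (x : V ⊕ F → ℝ) (Sum.inr f) = 0 := by
  constructor
  · rintro (⟨v, rfl⟩ | hx) f
    · change (Pi.single (Sum.inl v) 1 : V ⊕ F → ℝ) (Sum.inr f) = 0
      simp
    · rw [Set.mem_iUnion] at hx
      obtain ⟨e, u, v, h, -, t, rfl⟩ := hx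
      exact edgePt_of_ne (by simp) (by simp) _
  · intro hx
    obtain ⟨T, ⟨f, c, rfl⟩, hs⟩ := x.2.2
    refine Or.inr (Set.mem_iUnion.2 ⟨s(Q.q f c, Q.q f (c + 1)), (Q.mem_edgeCarrier ?_ x).2 ?_⟩)
    · intro h
      have := Q.injective _ h
      revert this; fin_cases c <;> decide
    · intro w hw
      rcases hs hw with rfl | h
      · exact absurd (hx f) hw
      · exact h

/-- The complement of the graph is the disjoint union of the open stars of the centres. Each is open
and connected, so these are its components. -/
theorem eq_openFace_of_isFace {A : Set Q.Surface} (hA : Q.embedding.IsFace A) :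
    ∃ f, A = Q.openFace f := by
  obtain ⟨x, hx, rfl⟩ := hA
  have hx' := hx
  rw [Set.mem_compl_iff, mem_carrier] at hx'
  push Not at hx'
  obtain ⟨f, hf⟩ := hx'
  have hf : x ∈ Q.openFace f := lt_of_le_of_ne (x.2.1.1 _) hf.symm
  refine ⟨f, Set.Subset.antisymm ?_ ?_⟩
  · refine isPreconnected_connectedComponentIn.subset_left_of_subset_union (Q.isOpen_openFace f)
      (isOpen_biUnion fun g (_ : g ∈ ({f}ᶜ : Set F)) => Q.isOpen_openFace g) ?_ ?_
      ⟨x, mem_connectedComponentIn hx, hf⟩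
    · refine Set.disjoint_left.2 fun y hy hy' => ?_
      simp only [Set.mem_iUnion] at hy'
      obtain ⟨g, hg, hyg⟩ := hy'
      exact hg (Q.eq_of_pos y hyg hy)
    · refine (connectedComponentIn_subset _ _).trans fun y hy => ?_
      rw [Set.mem_compl_iff, mem_carrier] at hy
      push Not at hy
      obtain ⟨g, hg⟩ := hy
      have hg : y ∈ Q.openFace g := lt_of_le_of_ne (y.2.1.1 _) hg.symm
      by_cases h : g = f
      · exact Or.inl (h ▸ hg)
      · exact Or.inr (Set.mem_biUnion (show g ∈ ({f}ᶜ : Set F) from h) hg)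
  · refine (Q.isPreconnected_openFace f).subset_connectedComponentIn hf fun y hy => ?_
    rw [Set.mem_compl_iff, mem_carrier]
    push Not
    exact ⟨f, hy.ne'⟩

theorem mem_walkCarrier_boundary (f : F) (x : Q.Surface) :
    x ∈ Q.embedding.walkCarrier (Q.boundary f) ↔
      ∃ c, Function.support (x : V ⊕ F → ℝ) ⊆ {Sum.inl (Q.q f c), Sum.inl (Q.q f (c + 1))} := by
  have h : ∀ c, x ∈ Q.embedding.edgeCarrier s(Q.q f c, Q.q f (c + 1)) ↔
      Function.support (x : V ⊕ F → ℝ) ⊆ {Sum.inl (Q.q f c), Sum.inl (Q.q f (c + 1))} := fun c =>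
    Q.mem_edgeCarrier ((Q.injective f).ne (by fin_cases c <;> decide)) x
  simp only [← h]
  simp [GraphEmbedding.walkCarrier, boundary, Fin.exists_fin_succ]

theorem isBoundedBy_openFace (f : F) : Q.embedding.IsBoundedBy (Q.openFace f) (Q.boundary f) := by
  classical
  obtain ⟨φ, hφ, hn, hr⟩ := (Q.isCyclicLink_face f).exists_isEmbedding_closedBall
  have hr' : ∀ x : Q.Surface, x ∈ Set.range φ ↔ ∃ j < 4, Function.support (x : V ⊕ F → ℝ) ⊆
      {Sum.inr f, Sum.inl (Q.q f (Fin.ofNat 4 j)),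
        Sum.inl (Q.q f (Fin.ofNat 4 (j + 1)))} := fun x => by
    rw [hr]; rfl
  -- A default value outside the closed disk, where nothing is required of the map.
  let x₀ : Q.Surface := φ ⟨0, by simp⟩
  let ψ : Plane → Q.Surface := fun z => if h : z ∈ Metric.closedBall 0 1 then φ ⟨z, h⟩ else x₀
  have hψ : ∀ z (h : z ∈ Metric.closedBall 0 1), ψ z = φ ⟨z, h⟩ := fun z h => dif_pos h
  have hψn : ∀ z ∈ Metric.closedBall (0 : Plane) 1,
      (ψ z : V ⊕ F → ℝ) (Sum.inr f) = 1 - ‖z‖ := fun z hz => by rw [hψ z hz, hn]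
  refine ⟨ψ, ?_, ?_, ?_, ?_⟩
  · rw [continuousOn_iff_continuous_domRestrict]
    exact hφ.continuous.congr fun z => (hψ z z.2).symm
  · intro z hz z' hz' h
    rw [hψ z hz, hψ z' hz'] at h
    exact congrArg Subtype.val (hφ.injective h)
  · ext x
    constructor
    · rintro ⟨z, hz, rfl⟩
      change 0 < (ψ z : V ⊕ F → ℝ) (Sum.inr f)
      rw [hψn z (Metric.ball_subset_closedBall hz)]
      exact sub_pos.2 (mem_ball_zero_iff.1 hz)
    · intro hx
      obtain ⟨T, hT, hs⟩ := x.2.2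
      obtain ⟨j, hj, hTj⟩ := (Q.isCyclicLink_face f).subset T hT (hs (ne_of_gt hx))
      obtain ⟨z, rfl⟩ := (hr' x).2 ⟨j, hj, hs.trans hTj⟩
      have hx : 0 < (φ z : V ⊕ F → ℝ) (Sum.inr f) := hx
      rw [hn] at hx
      exact ⟨z, mem_ball_zero_iff.2 (by linarith), hψ z z.2⟩
  · ext x
    rw [mem_walkCarrier_boundary]
    constructor
    · rintro ⟨z, hz, rfl⟩
      have hz' := Metric.sphere_subset_closedBall hz
      have h0 := hψn z hz'
      rw [mem_sphere_zero_iff_norm.1 hz, sub_self] at h0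
      obtain ⟨j, -, hs⟩ := (hr' (ψ z)).1 ⟨⟨z, hz'⟩, (hψ z hz').symm⟩
      refine ⟨Fin.ofNat 4 j, fun w hw => ?_⟩
      rw [ofNat_four_succ] at hs
      rcases hs hw with rfl | h
      · exact absurd h0 hw
      · exact h
    · rintro ⟨c, hc⟩
      obtain ⟨z, rfl⟩ := (hr' x).2 ⟨c, c.2, by
        rw [ofNat_four_succ, Fin.ofNat_val_eq_self]
        exact hc.trans (Set.subset_insert _ _)⟩
      refine ⟨z, ?_, hψ z z.2⟩
      have : (φ z : V ⊕ F → ℝ) (Sum.inr f) = 0 := by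
        by_contra h
        simpa using hc h
      rw [hn] at this
      exact mem_sphere_zero_iff_norm.2 (by linarith)

theorem isQuadrangular : Q.embedding.IsQuadrangular := by
  constructor
  · intro A hA
    obtain ⟨f, rfl⟩ := Q.eq_openFace_of_isFace hA
    exact Q.nonempty_homeomorph_openFace f
  · intro A hA
    obtain ⟨f, rfl⟩ := Q.eq_openFace_of_isFace hA
    exact ⟨_, Q.boundary f, Q.isCycle_boundary f, rfl, Q.isBoundedBy_openFace f⟩

end CompleteQuadrangulation

/-! ### A square parametrizing one quadrangle -/

section square

variable {W : Type*} [DecidableEq W]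

/-- The point `(x, y)` of the square `[-1, 1] × [-1, 1]` with centre `o` and corners `b = (-1, -1)`,
`t = (-1, 1)`, `b' = (1, -1)`, `t' = (1, 1)`. -/
noncomputable def squarePt (o b t b' t' : W) (p : ℝ × ℝ) : W → ℝ :=
  Pi.single o (1 - max |p.1| |p.2|) + Pi.single b (max (-p.1 - p.2) 0 / 2) +
    Pi.single t (max (-p.1 + p.2) 0 / 2) + Pi.single b' (max (p.1 - p.2) 0 / 2) +
    Pi.single t' (max (p.1 + p.2) 0 / 2)

theorem continuous_squarePt (o b t b' t' : W) : Continuous (squarePt o b t b' t') := by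
  unfold squarePt
  have h : ∀ (c : W) (f : ℝ × ℝ → ℝ), Continuous f →
      Continuous fun p => (Pi.single c (f p) : W → ℝ) := fun c f hf =>
    (continuous_single (A := fun _ : W => ℝ) c).comp hf
  exact ((((h _ _ (by fun_prop)).add (h _ _ (by fun_prop))).add (h _ _ (by fun_prop))).add
    (h _ _ (by fun_prop))).add (h _ _ (by fun_prop))

/-- Both sides equal |x + y| + |x − y|. This makes the coordinates of `squarePt` sum to 1. -/
theorem max_add_max_eq (x y : ℝ) :
    max (-x - y) 0 + max (-x + y) 0 + max (x - y) 0 + max (x + y) 0 = 2 * max |x| |y| := by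
  rcases le_total 0 (x + y) with h1 | h1 <;> rcases le_total 0 (x - y) with h2 | h2
  · rw [max_eq_right (by linarith), max_eq_right (by linarith), max_eq_left h2, max_eq_left h1,
      abs_of_nonneg (by linarith : 0 ≤ x), max_eq_left (abs_le.2 ⟨by linarith, by linarith⟩)]
    ring
  · rw [max_eq_right (by linarith), max_eq_left (by linarith), max_eq_right h2, max_eq_left h1,
      abs_of_nonneg (by linarith : 0 ≤ y), max_eq_right (abs_le.2 ⟨by linarith, by linarith⟩)]
    ring
  · rw [max_eq_left (by linarith), max_eq_right (by linarith), max_eq_left h2, max_eq_right h1,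
      abs_of_nonpos (by linarith : y ≤ 0), max_eq_right (abs_le.2 ⟨by linarith, by linarith⟩)]
    ring
  · rw [max_eq_left (by linarith), max_eq_left (by linarith), max_eq_right h2, max_eq_right h1,
      abs_of_nonpos (by linarith : x ≤ 0), max_eq_left (abs_le.2 ⟨by linarith, by linarith⟩)]
    ring

theorem squarePt_mem_stdSimplex [Fintype W] (o b t b' t' : W) {p : ℝ × ℝ} (h1 : |p.1| ≤ 1)
    (h2 : |p.2| ≤ 1) : squarePt o b t b' t' p ∈ stdSimplex ℝ W := by
  constructor
  · intro w
    have h : ∀ (c : W) (x : ℝ), 0 ≤ x → (0 : ℝ) ≤ (Pi.single c x : W → ℝ) w := fun c x hx =>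
      (Pi.single_nonneg.2 hx : (0 : W → ℝ) ≤ Pi.single c x) w
    have h' : ∀ (c : W) (x : ℝ), (0 : ℝ) ≤ (Pi.single c (max x 0 / 2) : W → ℝ) w := fun c x =>
      h c _ (by positivity)
    have h0 := h o (1 - max |p.1| |p.2|) (sub_nonneg.2 (max_le h1 h2))
    exact add_nonneg (add_nonneg (add_nonneg (add_nonneg h0 (h' _ _)) (h' _ _)) (h' _ _)) (h' _ _)
  · simp only [squarePt, Pi.add_apply, Finset.sum_add_distrib, Finset.sum_pi_single',
      Finset.mem_univ, if_true]
    linarith [max_add_max_eq p.1 p.2]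

/-- The diagonals cut the square into four triangles according to the signs of x + y and x − y. On
each triangle one of every two opposite corners has weight 0. -/
theorem support_squarePt (o b t b' t' : W) (p : ℝ × ℝ) :
    Function.support (squarePt o b t b' t' p) ⊆ {o, b, t} ∨
    Function.support (squarePt o b t b' t' p) ⊆ {o, b, b'} ∨
    Function.support (squarePt o b t b' t' p) ⊆ {o, t, t'} ∨
    Function.support (squarePt o b t b' t' p) ⊆ {o, b', t'} := by
  have key : ∀ {c c' : W} {w : W} {x x' : ℝ},
      (Pi.single o (1 - max |p.1| |p.2|) + Pi.single c x + Pi.single c' x' : W → ℝ) w ≠ 0 →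
        w ∈ ({o, c, c'} : Set W) := by
    intro c c' w x x' h
    by_contra hw
    simp only [Set.mem_insert_iff, Set.mem_singleton_iff, not_or] at hw
    exact h (by simp [hw.1, hw.2.1, hw.2.2])
  rcases le_total 0 (p.1 + p.2) with h1 | h1 <;> rcases le_total 0 (p.1 - p.2) with h2 | h2
  · refine Or.inr (Or.inr (Or.inr fun w hw => key (x := max (p.1 - p.2) 0 / 2)
      (x' := max (p.1 + p.2) 0 / 2) ?_))
    simpa [squarePt, max_eq_right (by linarith : -p.1 - p.2 ≤ 0),
      max_eq_right (by linarith : -p.1 + p.2 ≤ 0)] using hw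
  · refine Or.inr (Or.inr (Or.inl fun w hw => key (x := max (-p.1 + p.2) 0 / 2)
      (x' := max (p.1 + p.2) 0 / 2) ?_))
    simpa [squarePt, max_eq_right (by linarith : -p.1 - p.2 ≤ 0), max_eq_right h2] using hw
  · refine Or.inr (Or.inl fun w hw => key (x := max (-p.1 - p.2) 0 / 2)
      (x' := max (p.1 - p.2) 0 / 2) ?_)
    simpa [squarePt, max_eq_right h1, max_eq_right (by linarith : -p.1 + p.2 ≤ 0)] using hw
  · refine Or.inl fun w hw => key (x := max (-p.1 - p.2) 0 / 2)
      (x' := max (-p.1 + p.2) 0 / 2) ?_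
    simpa [squarePt, max_eq_right h1, max_eq_right h2] using hw

theorem squarePt_neg_one (o b t b' t' : W) {y : ℝ} (hy : |y| ≤ 1) :
    squarePt o b t b' t' (-1, y) = edgePt b t ((1 + y) / 2) := by
  obtain ⟨h1, h2⟩ := abs_le.1 hy
  have e : 1 - (1 + y) / 2 = (1 - y) / 2 := by ring
  simp [squarePt, edgePt, max_eq_left hy, max_eq_right (by linarith : -1 - y ≤ 0),
    max_eq_right (by linarith : -1 + y ≤ 0), max_eq_left (by linarith : 0 ≤ 1 - y),
    max_eq_left (by linarith : 0 ≤ 1 + y), e]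

theorem squarePt_one (o b t b' t' : W) {y : ℝ} (hy : |y| ≤ 1) :
    squarePt o b t b' t' (1, y) = edgePt b' t' ((1 + y) / 2) := by
  obtain ⟨h1, h2⟩ := abs_le.1 hy
  have e : 1 - (1 + y) / 2 = (1 - y) / 2 := by ring
  simp [squarePt, edgePt, max_eq_left hy, max_eq_right (by linarith : -1 - y ≤ 0),
    max_eq_right (by linarith : -1 + y ≤ 0), max_eq_left (by linarith : 0 ≤ 1 - y),
    max_eq_left (by linarith : 0 ≤ 1 + y), e]

theorem squarePt_centre {o b t b' t' : W} (hb : o ≠ b) (ht : o ≠ t) (hb' : o ≠ b') (ht' : o ≠ t')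
    (p : ℝ × ℝ) : squarePt o b t b' t' p o = 1 - max |p.1| |p.2| := by
  simp [squarePt, hb, ht, hb', ht']

/-- The weights of opposite corners are half the positive and negative parts of x + y and of x − y,
so they recover both numbers. -/
theorem squarePt_injective {o b t b' t' : W} (h : [o, b, t, b', t'].Nodup) :
    Function.Injective (squarePt o b t b' t') := by
  simp only [List.nodup_cons, List.mem_cons, not_or] at h
  obtain ⟨⟨hob, hot, hob', hot', -⟩, ⟨hbt, hbb', hbt', -⟩, ⟨htb', htt', -⟩, ⟨hbt2, -⟩, -⟩ := h
  have eb : ∀ p, squarePt o b t b' t' p b = max (-p.1 - p.2) 0 / 2 := fun p => by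
    simp [squarePt, Ne.symm hob, hbt, hbb', hbt']
  have et : ∀ p, squarePt o b t b' t' p t = max (-p.1 + p.2) 0 / 2 := fun p => by
    simp [squarePt, Ne.symm hot, Ne.symm hbt, htb', htt']
  have eb' : ∀ p, squarePt o b t b' t' p b' = max (p.1 - p.2) 0 / 2 := fun p => by
    simp [squarePt, Ne.symm hob', Ne.symm hbb', Ne.symm htb', hbt2]
  have et' : ∀ p, squarePt o b t b' t' p t' = max (p.1 + p.2) 0 / 2 := fun p => by
    simp [squarePt, Ne.symm hot', Ne.symm hbt', Ne.symm htt', Ne.symm hbt2]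
  have hmax : ∀ x : ℝ, max x 0 - max (-x) 0 = x := fun x => by
    rcases le_total 0 x with hx | hx
    · rw [max_eq_left hx, max_eq_right (by linarith)]; ring
    · rw [max_eq_right hx, max_eq_left (by linarith)]; ring
  intro p p' hp
  have h1 := congrFun hp b
  have h2 := congrFun hp t
  have h3 := congrFun hp b'
  have h4 := congrFun hp t'
  rw [eb, eb] at h1
  rw [et, et] at h2
  rw [eb', eb'] at h3
  rw [et', et'] at h4
  have k : ∀ r : ℝ × ℝ, -r.1 - r.2 = -(r.1 + r.2) ∧ -r.1 + r.2 = -(r.1 - r.2) := fun r =>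
    ⟨by ring, by ring⟩
  rw [(k p).1, (k p').1] at h1
  rw [(k p).2, (k p').2] at h2
  have a1 := hmax (p.1 + p.2)
  have a2 := hmax (p'.1 + p'.2)
  have a3 := hmax (p.1 - p.2)
  have a4 := hmax (p'.1 - p'.2)
  exact Prod.ext (by linarith) (by linarith)

end square

/-! ### Twisted strips contain Möbius bands -/

namespace CompleteQuadrangulation

variable {V F : Type*} (Q : CompleteQuadrangulation V F)

/-- A closed strip of quadrangles `g 0, …, g (m - 1)`, consecutive ones being glued along the
opposite sides `b i – t i`, that closes up with a twist. -/
structure IsTwistedStrip (m : ℕ) (g : ℕ → F) (b t : ℕ → V) : Prop where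
  pos : 0 < m
  injOn : Set.InjOn g (Set.Iio m)
  -- The sign of e = ±1 (with 3 = −1) is the direction in which the corners are read, which may vary
  -- along the strip.
  quad : ∀ i < m, ∃ c e : Fin 4, (e = 1 ∨ e = 3) ∧ Q.q (g i) c = b i ∧
    Q.q (g i) (c + e) = b (i + 1) ∧ Q.q (g i) (c + 2) = t (i + 1) ∧ Q.q (g i) (c + 3 * e) = t i
  edge : ∀ i < m, ∀ j < m, s(b i, t i) = s(b j, t j) → i = j
  closed_b : b m = t 0
  closed_t : t m = b 0

variable {Q}

theorem IsTwistedStrip.nodup {m : ℕ} {g : ℕ → F} {b t : ℕ → V} (h : Q.IsTwistedStrip m g b t)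
    {i : ℕ} (hi : i < m) :
    [(Sum.inr (g i) : V ⊕ F), Sum.inl (b i), Sum.inl (t i), Sum.inl (b (i + 1)),
      Sum.inl (t (i + 1))].Nodup := by
  obtain ⟨c, e, he, h1, h2, h3, h4⟩ := h.quad i hi
  rw [← h1, ← h2, ← h3, ← h4]
  have hq : ∀ x y, Q.q (g i) x = Q.q (g i) y ↔ x = y := fun x y => (Q.injective _).eq_iff
  rcases he with rfl | rfl <;> fin_cases c <;> simp [hq]

theorem IsTwistedStrip.ne {m : ℕ} {g : ℕ → F} {b t : ℕ → V} (h : Q.IsTwistedStrip m g b t)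
    {i : ℕ} (hi : i ≤ m) : (Sum.inl (b i) : V ⊕ F) ≠ Sum.inl (t i) := by
  have key : ∀ j < m, (Sum.inl (b j) : V ⊕ F) ≠ Sum.inl (t j) := fun j hj => by
    have := h.nodup hj
    simp only [List.nodup_cons, List.mem_cons, not_or] at this
    exact this.2.1.1
  rcases hi.eq_or_lt with rfl | hi
  · rw [h.closed_b, h.closed_t]
    exact (key 0 h.pos).symm
  · exact key i hi

variable [Fintype V] [Fintype F] [DecidableEq V] [DecidableEq F]

theorem IsTwistedStrip.squarePt_mem {m : ℕ} {g : ℕ → F} {b t : ℕ → V}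
    (h : Q.IsTwistedStrip m g b t) {i : ℕ} (hi : i < m) {p : ℝ × ℝ} (h1 : |p.1| ≤ 1)
    (h2 : |p.2| ≤ 1) :
    squarePt (Sum.inr (g i)) (Sum.inl (b i)) (Sum.inl (t i)) (Sum.inl (b (i + 1)))
      (Sum.inl (t (i + 1))) p ∈ realization Q.facets := by
  refine ⟨squarePt_mem_stdSimplex _ _ _ _ _ h1 h2, ?_⟩
  obtain ⟨c, e, he, hc1, hc2, hc3, hc4⟩ := h.quad i hi
  have key : ∀ x y : Fin 4, (y = x + 1 ∨ x = y + 1) → ∃ T ∈ Q.facets,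
      ({Sum.inr (g i), Sum.inl (Q.q (g i) x), Sum.inl (Q.q (g i) y)} : Set (V ⊕ F)) ⊆ T := by
    rintro x y (rfl | rfl)
    · exact ⟨_, ⟨g i, x, rfl⟩, subset_rfl⟩
    · refine ⟨_, ⟨g i, y, rfl⟩, ?_⟩
      intro z; simp only [Set.mem_insert_iff, Set.mem_singleton_iff]; tauto
  rw [← hc1, ← hc2, ← hc3, ← hc4]
  have fin : ∀ {x y : Fin 4} {A : Set (V ⊕ F)}, (y = x + 1 ∨ x = y + 1) →
      A ⊆ {Sum.inr (g i), Sum.inl (Q.q (g i) x), Sum.inl (Q.q (g i) y)} →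
      ∃ T ∈ Q.facets, A ⊆ T := by
    intro x y A hxy hA
    obtain ⟨T, hT, hs⟩ := key x y hxy
    exact ⟨T, hT, hA.trans hs⟩
  rcases support_squarePt (Sum.inr (g i) : V ⊕ F) (Sum.inl (Q.q (g i) c))
    (Sum.inl (Q.q (g i) (c + 3 * e))) (Sum.inl (Q.q (g i) (c + e)))
    (Sum.inl (Q.q (g i) (c + 2))) p with hs | hs | hs | hs <;> refine fin ?_ hs <;>
    clear * - he <;> revert c e <;> decide

theorem IsTwistedStrip.isNonorientable {m : ℕ} {g : ℕ → F} {b t : ℕ → V}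
    (h : Q.IsTwistedStrip m g b t) : IsNonorientable Q.Surface := by
  have hm : (0 : ℝ) < m := by exact_mod_cast h.pos
  let A := Fin m × unitInterval × unitInterval
  have hx : ∀ a : A, |2 * (a.2.1 : ℝ) - 1| ≤ 1 := fun a =>
    abs_le.2 ⟨by linarith [a.2.1.2.1], by linarith [a.2.1.2.2]⟩
  -- Only the middle half |y| ≤ 1/2 of each square is used. The strip may visit a vertex several
  -- times, and this keeps the band away from the vertices.
  have hy : ∀ s : unitInterval, |(s : ℝ) - 1 / 2| < 1 := fun s =>
    abs_lt.2 ⟨by linarith [s.2.1], by linarith [s.2.2]⟩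
  let G : A → Q.Surface := fun a => ⟨_, h.squarePt_mem a.1.2 (p := (2 * (a.2.1 : ℝ) - 1,
    (a.2.2 : ℝ) - 1 / 2)) (hx a) (hy _).le⟩
  have hG : Continuous G := by
    refine Continuous.subtype_mk (continuous_prod_of_discrete_left.2 fun i => ?_) _
    have : Continuous fun z : unitInterval × unitInterval =>
        ((2 * (z.1 : ℝ) - 1, (z.2 : ℝ) - 1 / 2) : ℝ × ℝ) := by fun_prop
    exact (continuous_squarePt (Sum.inr (g i) : V ⊕ F) (Sum.inl (b i)) (Sum.inl (t i))
      (Sum.inl (b (i + 1))) (Sum.inl (t (i + 1)))).comp this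
  -- the transversal segments at the ends of the quadrangles
  let E : ℕ → unitInterval → V ⊕ F → ℝ := fun e s =>
    edgePt (Sum.inl (b e)) (Sum.inl (t e)) ((1 + ((s : ℝ) - 1 / 2)) / 2)
  have hG0 : ∀ a : A, (a.2.1 : ℝ) = 0 → (G a : V ⊕ F → ℝ) = E a.1 a.2.2 := fun a ha => by
    change squarePt _ _ _ _ _ (2 * (a.2.1 : ℝ) - 1, _) = _
    rw [ha, mul_zero, zero_sub]
    exact squarePt_neg_one _ _ _ _ _ (hy _).le
  have hG1 : ∀ a : A, (a.2.1 : ℝ) = 1 → (G a : V ⊕ F → ℝ) = E (a.1 + 1) a.2.2 := fun a ha => by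
    change squarePt _ _ _ _ _ (2 * (a.2.1 : ℝ) - 1, _) = _
    rw [ha, show (2 * 1 - 1 : ℝ) = 1 by norm_num]
    exact squarePt_one _ _ _ _ _ (hy _).le
  -- The twist: exchanging b and t at the end of the strip reverses the transversal segment, as in
  -- the Möbius gluing.
  have hE : ∀ s, E m (unitInterval.symm s) = E 0 s := fun s => by
    change edgePt _ _ ((1 + ((1 - s : ℝ) - 1 / 2)) / 2) = edgePt _ _ _
    rw [h.closed_b, h.closed_t, edgePt_symm]
    congr 1
    ring
  have hEinj : ∀ e ≤ m, ∀ s s', E e s = E e s' → s = s' := fun e he s s' hs => by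
    have := edgePt_injective (h.ne he) hs
    exact Subtype.ext (by linarith)
  have hEeq : ∀ e ≤ m, ∀ e' ≤ m, ∀ s s', E e s = E e' s' →
      s(b e, t e) = s(b e', t e') := by
    intro e he e' _ s s' hs
    have hs0 := abs_lt.1 (hy s)
    have := eq_of_edgePt_eq (h.ne he) (by linarith) (by linarith) hs
    simpa [Sym2.eq_iff] using this
  have hEfib : ∀ e ≤ m, ∀ e' ≤ m, ∀ s s', E e s = E e' s' → (e = e' ∧ s = s') ∨
      (e = 0 ∧ e' = m ∧ s' = unitInterval.symm s) ∨
      (e = m ∧ e' = 0 ∧ s = unitInterval.symm s') := by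
    intro e he e' he' s s' hs
    have hsym := hEeq e he e' he' s s' hs
    have hm0 : s(b m, t m) = s(b 0, t 0) := by rw [h.closed_b, h.closed_t, Sym2.eq_swap]
    rcases he.eq_or_lt with rfl | he1 <;> rcases he'.eq_or_lt with rfl | he1'
    · exact Or.inl ⟨rfl, hEinj _ he _ _ hs⟩
    · rw [hm0] at hsym
      obtain rfl := h.edge 0 h.pos e' he1' hsym
      rw [← hE] at hs
      exact Or.inr (Or.inr ⟨rfl, rfl, hEinj _ he _ _ hs⟩)
    · rw [hm0] at hsym
      obtain rfl := h.edge e he1 0 h.pos hsym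
      rw [← hE] at hs
      exact Or.inr (Or.inl ⟨rfl, rfl, (hEinj _ he' _ _ hs).symm⟩)
    · obtain rfl := h.edge e he1 e' he1' hsym
      exact Or.inl ⟨rfl, hEinj _ he _ _ hs⟩
  -- the strip as a rectangle
  let p : A → unitInterval × unitInterval := fun a =>
    (⟨((a.1 : ℕ) + (a.2.1 : ℝ)) / m, div_nonneg (add_nonneg (Nat.cast_nonneg _) a.2.1.2.1) hm.le,
      (div_le_one hm).2 (by
        have : ((a.1 : ℕ) : ℝ) + 1 ≤ m := by exact_mod_cast a.1.2
        linarith [a.2.1.2.2])⟩, a.2.2)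
  have hpc : Continuous p := by
    refine continuous_prod_of_discrete_left.2 fun i => ?_
    refine Continuous.prodMk (Continuous.subtype_mk ?_ _) (by fun_prop)
    fun_prop
  have hps : Function.Surjective p := by
    rintro ⟨s, y⟩
    have hms : 0 ≤ m * (s : ℝ) := mul_nonneg hm.le s.2.1
    by_cases hs1 : (s : ℝ) = 1
    · refine ⟨(⟨m - 1, by have := h.pos; omega⟩, 1, y), Prod.ext (Subtype.ext ?_) rfl⟩
      change (((m - 1 : ℕ) : ℝ) + 1) / m = s
      rw [Nat.cast_sub h.pos, hs1]
      field_simp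
      simp
    · have hlt : m * (s : ℝ) < m := by
        have := lt_of_le_of_ne s.2.2 hs1
        nlinarith
      refine ⟨(⟨⌊m * (s : ℝ)⌋₊, (Nat.floor_lt hms).2 hlt⟩, ⟨m * (s : ℝ) - ⌊m * (s : ℝ)⌋₊,
        ?_, ?_⟩, y), Prod.ext (Subtype.ext ?_) rfl⟩
      · linarith [Nat.floor_le hms]
      · linarith [Nat.lt_floor_add_one (m * (s : ℝ))]
      · change (_ + (m * (s : ℝ) - _)) / m = s
        field_simp
        ring
  have hp_iff : ∀ a a' : A, p a = p a' ↔
      ((a.1 : ℕ) : ℝ) + (a.2.1 : ℝ) = (a'.1 : ℕ) + (a'.2.1 : ℝ) ∧ a.2.2 = a'.2.2 := by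
    intro a a'
    rw [Prod.ext_iff, Subtype.ext_iff]
    exact and_congr_left' (div_left_inj' hm.ne')
  have hpG : ∀ a a', p a = p a' → G a = G a' := by
    have aux : ∀ a a' : A, a.1 < a'.1 → p a = p a' → G a = G a' := by
      intro a a' hlt hp
      obtain ⟨h1, h2⟩ := (hp_iff a a').1 hp
      have hle : ((a.1 : ℕ) : ℝ) + 1 ≤ (a'.1 : ℕ) := by exact_mod_cast hlt
      have ha1 : (a.2.1 : ℝ) = 1 := by linarith [a.2.1.2.2, a'.2.1.2.1]
      have ha0 : (a'.2.1 : ℝ) = 0 := by linarith [a.2.1.2.2, a'.2.1.2.1]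
      have hi : (a.1 : ℕ) + 1 = a'.1 := by
        rw [ha1, ha0, add_zero] at h1
        exact_mod_cast h1
      exact Subtype.ext (by rw [hG1 a ha1, hG0 a' ha0, hi, h2])
    intro a a' hp
    rcases lt_trichotomy a.1 a'.1 with hlt | heq | hlt
    · exact aux a a' hlt hp
    · obtain ⟨h1, h2⟩ := (hp_iff a a').1 hp
      rw [heq] at h1
      have : a = a' := Prod.ext heq (Prod.ext (Subtype.ext (by linarith)) h2)
      rw [this]
    · exact (aux a' a hlt hp.symm).symm
  let π : A → MoebiusBand := fun a => Quot.mk _ (p a)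
  have hπ : IsQuotientMap π :=
    isQuotientMap_quot_mk.comp (hpc.isClosedMap.isQuotientMap hpc hps)
  have hglue : ∀ x y : unitInterval × unitInterval, MoebiusGlue x y →
      G (Function.surjInv hps x) = G (Function.surjInv hps y) := by
    rintro ⟨x1, x2⟩ ⟨y1, y2⟩ ⟨h1, h2, h3⟩
    dsimp only at h1 h2 h3
    subst h1 h2 h3
    let a0 : A := (⟨0, h.pos⟩, 0, x2)
    let a1 : A := (⟨m - 1, by have := h.pos; omega⟩, 1, unitInterval.symm x2)
    have e0 : p a0 = (0, x2) := Prod.ext (Subtype.ext (by simp [p, a0])) rfl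
    have e1 : p a1 = (1, unitInterval.symm x2) := Prod.ext (Subtype.ext (by
      simp [p, a1, Nat.cast_sub (show 1 ≤ m from h.pos), hm.ne'])) rfl
    rw [hpG _ a0 ((Function.surjInv_eq hps _).trans e0.symm),
      hpG _ a1 ((Function.surjInv_eq hps _).trans e1.symm)]
    refine Subtype.ext ?_
    rw [hG0 a0 rfl, hG1 a1 rfl]
    change E 0 x2 = E (m - 1 + 1) (unitInterval.symm x2)
    rw [Nat.sub_add_cancel (show 1 ≤ m from h.pos), hE]
  have hfib : ∀ a a', π a = π a' ↔ G a = G a' := by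
    intro a a'
    constructor
    · intro hp
      have := congrArg (Quot.lift (fun x => G (Function.surjInv hps x)) hglue) hp
      change G (Function.surjInv hps (p a)) = G (Function.surjInv hps (p a')) at this
      rwa [hpG _ a (Function.surjInv_eq hps _), hpG _ a' (Function.surjInv_eq hps _)] at this
    -- Points inside a quadrangle have positive weight at its centre, which identifies the
    -- quadrangle. Points on transversal segments have weight 0 at every centre and are compared by
    -- `hEfib`.
    · intro hGa
      have hcen : ∀ c : A, (G c : V ⊕ F → ℝ) (Sum.inr (g c.1)) =
          1 - max |2 * (c.2.1 : ℝ) - 1| |(c.2.2 : ℝ) - 1 / 2| := fun c =>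
        squarePt_centre (by simp) (by simp) (by simp) (by simp) _
      have hpos : ∀ c : A, (c.2.1 : ℝ) ≠ 0 → (c.2.1 : ℝ) ≠ 1 →
          0 < (G c : V ⊕ F → ℝ) (Sum.inr (g c.1)) := fun c h0 h1 => by
        rw [hcen, sub_pos]
        have h0 := lt_of_le_of_ne c.2.1.2.1 h0.symm
        have h1 := lt_of_le_of_ne c.2.1.2.2 h1
        exact max_lt (abs_lt.2 ⟨by linarith, by linarith⟩) (hy _)
      -- the end of the quadrangle containing a point on a transversal segment
      have hend : ∀ c : A, ((c.2.1 : ℝ) = 0 ∨ (c.2.1 : ℝ) = 1) → ∃ e ≤ m,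
          (G c : V ⊕ F → ℝ) = E e c.2.2 ∧ ((c.1 : ℕ) : ℝ) + (c.2.1 : ℝ) = e := by
        rintro c (hc | hc)
        · exact ⟨c.1, c.1.2.le, hG0 c hc, by rw [hc, add_zero]⟩
        · exact ⟨c.1 + 1, c.1.2, hG1 c hc, by rw [hc]; push_cast; rfl⟩
      have hzero : ∀ c : A, ((c.2.1 : ℝ) = 0 ∨ (c.2.1 : ℝ) = 1) → ∀ f,
          (G c : V ⊕ F → ℝ) (Sum.inr f) = 0 := by
        intro c hc f
        obtain ⟨e, -, he, -⟩ := hend c hc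
        rw [he]
        exact edgePt_of_ne (by simp) (by simp) _
      by_cases ha : (a.2.1 : ℝ) = 0 ∨ (a.2.1 : ℝ) = 1
      · have ha' : (a'.2.1 : ℝ) = 0 ∨ (a'.2.1 : ℝ) = 1 := by
          by_contra hc
          push Not at hc
          have := hpos a' hc.1 hc.2
          rw [← hGa, hzero a ha] at this
          exact lt_irrefl _ this
        obtain ⟨e, he, hGe, hpe⟩ := hend a ha
        obtain ⟨e', he', hGe', hpe'⟩ := hend a' ha'
        have hEE : E e a.2.2 = E e' a'.2.2 := by rw [← hGe, ← hGe', hGa]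
        have hfst : ∀ c : A, ∀ k : ℕ, ((c.1 : ℕ) : ℝ) + (c.2.1 : ℝ) = k →
            (k = 0 → (p c).1 = 0) ∧ (k = m → (p c).1 = 1) := by
          intro c k hk
          constructor <;> rintro rfl <;> refine Subtype.ext ?_
          · change (((c.1 : ℕ) : ℝ) + (c.2.1 : ℝ)) / m = 0
            rw [hk]; simp
          · change (((c.1 : ℕ) : ℝ) + (c.2.1 : ℝ)) / k = 1
            rw [hk, div_self hm.ne']
        rcases hEfib e he e' he' _ _ hEE with ⟨rfl, hs⟩ | ⟨h1, h2, hs⟩ | ⟨h1, h2, hs⟩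
        · exact congrArg (Quot.mk MoebiusGlue) ((hp_iff a a').2 ⟨hpe.trans hpe'.symm, hs⟩)
        · exact Quot.sound ⟨(hfst a e hpe).1 h1, (hfst a' e' hpe').2 h2, hs⟩
        · exact (Quot.sound ⟨(hfst a' e' hpe').1 h2, (hfst a e hpe).2 h1, hs⟩).symm
      · push Not at ha
        have h1 := hpos a ha.1 ha.2
        have h2 : ¬ ((a'.2.1 : ℝ) = 0 ∨ (a'.2.1 : ℝ) = 1) := fun hc => by
          rw [hGa, hzero a' hc] at h1
          exact lt_irrefl _ h1
        push Not at h2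
        have h2 := hpos a' h2.1 h2.2
        rw [hGa] at h1
        have hi : a.1 = a'.1 := Fin.ext (h.injOn a.1.2 a'.1.2 (Q.eq_of_pos (G a') h1 h2))
        have hsq : squarePt _ _ _ _ _ _ = squarePt _ _ _ _ _ _ := Subtype.ext_iff.1 hGa
        rw [hi] at hsq
        have := squarePt_injective (h.nodup a'.1.2) hsq
        rw [Prod.mk.injEq] at this
        have : a = a' := Prod.ext hi (Prod.ext (Subtype.ext (by linarith [this.1]))
          (Subtype.ext (by linarith [this.2])))
        rw [this]
  obtain ⟨φ, hφ, -⟩ := exists_isEmbedding_of_fibres_eq hπ hG hfib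
  exact ⟨φ, hφ⟩

end CompleteQuadrangulation

/-! ### The cyclic quadrangulation on 4k + 4 vertices -/

section construction

variable (k : ℕ)

/-- The position, relative to its first corner, of the corner `c` of a quadrangle of type `i`. -/
def cornerOffset (i : ℕ) : Fin 4 → ℕ := ![0, 2 * k + 2 - i, 1, i + 1]

/-- The corners of the quadrangle `(y, i)`: these are `y`, `y + 2k + 2 - i`, `y + 1`, `y + i + 1`,
except that `y + 1` is replaced by the additional vertex if `i = 0`. -/
def quad (f : ZMod (4 * k + 3) × Fin (k + 1)) (c : Fin 4) : Option (ZMod (4 * k + 3)) :=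
  if c = 2 ∧ f.2 = 0 then none else some (f.1 + (cornerOffset k f.2 c : ZMod (4 * k + 3)))

variable {k}

theorem four_mul_add_three : (4 * k + 3 : ZMod (4 * k + 3)) = 0 := by
  have := ZMod.natCast_self (4 * k + 3)
  push_cast at this
  exact this

theorem eq_of_natCast_eq {a b : ℕ} (ha : a < 4 * k + 3) (hb : b < 4 * k + 3)
    (h : (a : ZMod (4 * k + 3)) = b) : a = b := by
  rw [ZMod.natCast_eq_natCast_iff', Nat.mod_eq_of_lt ha, Nat.mod_eq_of_lt hb] at h
  exact h

/-- The offsets are distinct residues, except that for i = 0 those of the corners 2 and 3 coincide;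
there corner 2 is the additional vertex. -/
theorem quad_injective (f : ZMod (4 * k + 3) × Fin (k + 1)) : Function.Injective (quad k f) := by
  obtain ⟨y, i⟩ := f
  have hi := i.2
  have hlt : ∀ c, cornerOffset k i c < 4 * k + 3 := by
    intro c
    fin_cases c <;> simp [cornerOffset] <;> omega
  intro a b h
  unfold quad at h
  have h0 : i = 0 ↔ (i : ℕ) = 0 := by rw [Fin.ext_iff]; rfl
  split_ifs at h with h1 h2 h2
  · rw [h1.1, h2.1]
  · have := eq_of_natCast_eq (hlt a) (hlt b) (add_left_cancel (Option.some_injective _ h))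
    simp only [h0] at h1 h2
    clear h
    revert this h1 h2
    fin_cases a <;> fin_cases b <;> simp [cornerOffset] <;> omega

theorem quad_zero (y : ZMod (4 * k + 3)) (i : Fin (k + 1)) : quad k (y, i) 0 = some y := by
  simp [quad, cornerOffset]

theorem quad_one (y : ZMod (4 * k + 3)) (i : Fin (k + 1)) :
    quad k (y, i) 1 = some (y + (2 * k + 2 - (i : ℕ))) := by
  have : (i : ℕ) ≤ 2 * k + 2 := by have := i.2; omega
  simp [quad, cornerOffset, Nat.cast_sub this]

theorem quad_two (y : ZMod (4 * k + 3)) {i : Fin (k + 1)} (hi : (i : ℕ) ≠ 0) :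
    quad k (y, i) 2 = some (y + 1) := by
  have : i ≠ 0 := fun h => hi (by rw [h]; rfl)
  simp [quad, cornerOffset, this]

theorem quad_two_zero (y : ZMod (4 * k + 3)) : quad k (y, 0) 2 = none := by
  simp [quad]

theorem quad_three (y : ZMod (4 * k + 3)) (i : Fin (k + 1)) :
    quad k (y, i) 3 = some (y + ((i : ℕ) + 1)) := by
  simp [quad, cornerOffset]

variable (k)

/-- The position of the `j`-th neighbour of a vertex relative to it. -/
def neighbourOffset (j : ℕ) : ℕ := if j % 2 = 1 ∧ j < 2 * k + 2 then 2 * k + 2 - j else j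

/-- The `j`-th neighbour of `x`. -/
def neighbour (x : ZMod (4 * k + 3)) (j : ℕ) : Option (ZMod (4 * k + 3)) :=
  if j = 0 ∨ j = 4 * k + 3 then none else some (x + (neighbourOffset k j : ZMod (4 * k + 3)))

/-- The quadrangle at `x` between the neighbours number `j` and `j + 1`. -/
def faceBetween (x : ZMod (4 * k + 3)) (j : ℕ) : ZMod (4 * k + 3) × Fin (k + 1) :=
  if j = 0 then (x + (2 * k + 1), 0)
  else if j < 2 * k + 2 then
    (if j % 2 = 1 then x else x - 1, Fin.ofNat (k + 1) (min j (2 * k + 1 - j)))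
  else (x + j, Fin.ofNat (k + 1) (min (j - (2 * k + 1)) (4 * k + 2 - j)))

variable {k}

theorem neighbour_odd (x : ZMod (4 * k + 3)) {j : ℕ} (hj : j % 2 = 1) (hj' : j < 2 * k + 2) :
    neighbour k x j = some (x + (2 * k + 2 - j)) := by
  rw [neighbour, if_neg (by omega), neighbourOffset, if_pos ⟨hj, hj'⟩, Nat.cast_sub hj'.le]
  push_cast
  rfl

theorem neighbour_of_not (x : ZMod (4 * k + 3)) {j : ℕ} (hj0 : j ≠ 0) (hj1 : j ≠ 4 * k + 3)
    (hj : j % 2 = 0 ∨ 2 * k + 2 ≤ j) : neighbour k x j = some (x + j) := by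
  rw [neighbour, if_neg (by omega), neighbourOffset, if_neg (by omega)]

theorem faceBetween_odd (x : ZMod (4 * k + 3)) {j : ℕ} {i : Fin (k + 1)} (hj : j % 2 = 1)
    (hi : (i : ℕ) = j ∨ (i : ℕ) + j = 2 * k + 1) : faceBetween k x j = (x, i) := by
  have := i.2
  rw [faceBetween, if_neg (by omega), if_pos (by omega), if_pos hj]
  have h : min j (2 * k + 1 - j) = i := by omega
  rw [h, Fin.ofNat_val_eq_self]

theorem faceBetween_even (x : ZMod (4 * k + 3)) {j : ℕ} {i : Fin (k + 1)} (hj : j % 2 = 0)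
    (hj0 : j ≠ 0) (hi : (i : ℕ) = j ∨ (i : ℕ) + j = 2 * k + 1) :
    faceBetween k x j = (x - 1, i) := by
  have := i.2
  rw [faceBetween, if_neg (by omega), if_pos (by omega), if_neg (by omega)]
  have h : min j (2 * k + 1 - j) = i := by omega
  rw [h, Fin.ofNat_val_eq_self]

theorem faceBetween_of_le (x : ZMod (4 * k + 3)) {j : ℕ} {i : Fin (k + 1)} (hj : 2 * k + 2 ≤ j)
    (hi : (i : ℕ) + (2 * k + 1) = j ∨ (i : ℕ) + j = 4 * k + 2) :
    faceBetween k x j = (x + j, i) := by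
  have := i.2
  rw [faceBetween, if_neg (by omega), if_neg (by omega)]
  have h : min (j - (2 * k + 1)) (4 * k + 2 - j) = i := by omega
  rw [h, Fin.ofNat_val_eq_self]

/-- Around x the neighbours have offsets ∞, 2k + 1, 2, 2k − 1, 4, …, 2k, 1, 2k + 2, 2k + 3, …, 4k +
2. For 0 < j < 2k + 2 the vertex x is corner 0 (j odd) or 2 (j even); it is corner 1 for j = 0 and
for 2k + 2 ≤ j ≤ 3k + 1, and corner 3 afterwards. -/
theorem quad_faceBetween (x : ZMod (4 * k + 3)) {j : ℕ} (hj : j < 4 * k + 3) :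
    ∃ c, quad k (faceBetween k x j) c = some x ∧
      s(quad k (faceBetween k x j) (c + 1), quad k (faceBetween k x j) (c + 3)) =
        s(neighbour k x j, neighbour k x (j + 1)) := by
  have hN := four_mul_add_three (k := k)
  rcases Nat.eq_zero_or_pos j with rfl | hj0
  · refine ⟨1, ?_, ?_⟩
    · rw [faceBetween, if_pos rfl, quad_one]
      congr 1
      push_cast [Fin.val_zero]
      linear_combination hN
    · rw [faceBetween, if_pos rfl, show (1 + 1 : Fin 4) = 2 by rfl, show (1 + 3 : Fin 4) = 0 by rfl,
        quad_two_zero, quad_zero, neighbour_odd x (j := 0 + 1) (by norm_num) (by omega), neighbour,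
        if_pos (Or.inl rfl)]
      congr 2
      push_cast
      ring
  by_cases hlt : j < 2 * k + 2
  -- Replacing i by 2k + 1 − i exchanges the two neighbours of corner 0, and likewise of corner 2.
  -- So j and 2k + 1 − j describe the same pair, and the one that is at most k is a quadrangle type.
  · obtain ⟨i, hi⟩ : ∃ i : Fin (k + 1), (i : ℕ) = j ∨ (i : ℕ) + j = 2 * k + 1 := by
      by_cases h : j < k + 1
      · exact ⟨⟨j, h⟩, Or.inl rfl⟩
      · exact ⟨⟨2 * k + 1 - j, by omega⟩, Or.inr (by simp only; omega)⟩
    have hi' : (i : ZMod (4 * k + 3)) = j ∨ (i : ZMod (4 * k + 3)) = 2 * k + 1 - j := by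
      rcases hi with hi | hi
      · exact Or.inl (by rw [hi])
      · right
        have := congrArg (Nat.cast : ℕ → ZMod (4 * k + 3)) hi
        push_cast at this
        linear_combination this
    rcases Nat.mod_two_eq_zero_or_one j with hpar | hpar
    · have hi0 : (i : ℕ) ≠ 0 := by omega
      rw [faceBetween_even x hpar hj0.ne' hi]
      refine ⟨2, by rw [quad_two _ hi0, sub_add_cancel], ?_⟩
      rw [show (2 + 1 : Fin 4) = 3 by rfl, show (2 + 3 : Fin 4) = 1 by rfl, quad_three, quad_one,
        neighbour_of_not x hj0.ne' hj.ne (Or.inl hpar), neighbour_odd x (by omega) (by omega)]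
      rw [Sym2.eq_iff, Option.some_inj, Option.some_inj, Option.some_inj, Option.some_inj]
      push_cast
      rcases hi' with hi' | hi' <;> rw [hi']
      · left; constructor <;> ring
      · right; constructor <;> ring
    · rw [faceBetween_odd x hpar hi]
      refine ⟨0, quad_zero _ _, ?_⟩
      rw [show (0 + 1 : Fin 4) = 1 by rfl, show (0 + 3 : Fin 4) = 3 by rfl, quad_three, quad_one,
        neighbour_odd x hpar hlt, neighbour_of_not x (by omega) (by omega) (Or.inl (by omega))]
      rw [Sym2.eq_iff, Option.some_inj, Option.some_inj, Option.some_inj, Option.some_inj]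
      push_cast
      rcases hi' with hi' | hi' <;> rw [hi']
      · left; constructor <;> ring
      · right; constructor <;> ring
  · have hle : 2 * k + 2 ≤ j := by omega
    by_cases h : j ≤ 3 * k + 1
    · let i : Fin (k + 1) := ⟨j - (2 * k + 1), by omega⟩
      have hi : (i : ℕ) + (2 * k + 1) = j := Nat.sub_add_cancel (by omega)
      have hi' := congrArg (Nat.cast : ℕ → ZMod (4 * k + 3)) hi
      push_cast at hi'
      rw [faceBetween_of_le x hle (Or.inl hi)]
      refine ⟨1, ?_, ?_⟩
      · rw [quad_one]
        congr 1
        linear_combination hN - hi'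
      · rw [show (1 + 1 : Fin 4) = 2 by rfl, show (1 + 3 : Fin 4) = 0 by rfl,
          quad_two _ (by omega), quad_zero, neighbour_of_not x hj0.ne' hj.ne (Or.inr hle),
          neighbour_of_not x (by omega) (by omega) (Or.inr (by omega)), Sym2.eq_swap]
        push_cast
        rw [add_assoc]
    · let i : Fin (k + 1) := ⟨4 * k + 2 - j, by omega⟩
      have hi : (i : ℕ) + j = 4 * k + 2 := Nat.sub_add_cancel (by omega)
      have hi' := congrArg (Nat.cast : ℕ → ZMod (4 * k + 3)) hi
      push_cast at hi'
      rw [faceBetween_of_le x hle (Or.inr hi)]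
      refine ⟨3, ?_, ?_⟩
      · rw [quad_three]
        congr 1
        linear_combination hN + hi'
      · rw [show (3 + 1 : Fin 4) = 0 by rfl, show (3 + 3 : Fin 4) = 2 by rfl, quad_zero,
          neighbour_of_not x hj0.ne' hj.ne (Or.inr hle)]
        congr 2
        by_cases h0 : (i : ℕ) = 0
        · have : i = 0 := Fin.ext h0
          rw [this, quad_two_zero, neighbour, if_pos (by omega)]
        · rw [quad_two _ h0, neighbour_of_not x (by omega) (by omega) (Or.inr (by omega))]
          push_cast
          rw [add_assoc]

/-- Corners 1 and 3 determine j directly from i. For corners 0 and 2 the candidates are j = i and j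
= 2k + 1 − i, which have opposite parities, and the corner prescribes the parity. -/
theorem exists_eq_faceBetween (x : ZMod (4 * k + 3)) (f : ZMod (4 * k + 3) × Fin (k + 1))
    (c : Fin 4) (h : quad k f c = some x) : ∃ j < 4 * k + 3, f = faceBetween k x j := by
  have hN := four_mul_add_three (k := k)
  obtain ⟨y, i⟩ := f
  have hi := i.2
  have hc : c = 0 ∨ c = 1 ∨ c = 2 ∨ c = 3 := by clear h; revert c; decide
  rcases hc with rfl | rfl | rfl | rfl
  · rw [quad_zero, Option.some_inj] at h
    subst h
    rcases Nat.mod_two_eq_zero_or_one i with hpar | hpar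
    · exact ⟨2 * k + 1 - i, by omega, (faceBetween_odd y (by omega) (by omega)).symm⟩
    · exact ⟨i, by omega, (faceBetween_odd y hpar (Or.inl rfl)).symm⟩
  · rw [quad_one, Option.some_inj] at h
    by_cases h0 : (i : ℕ) = 0
    · obtain rfl : i = 0 := Fin.ext h0
      refine ⟨0, by omega, ?_⟩
      rw [faceBetween, if_pos rfl]
      push_cast [Fin.val_zero] at h
      refine Prod.ext ?_ rfl
      change y = x + (2 * k + 1)
      linear_combination h - hN
    · refine ⟨i + (2 * k + 1), by omega, ?_⟩
      rw [faceBetween_of_le x (by omega) (Or.inl rfl)]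
      refine Prod.ext ?_ rfl
      push_cast
      linear_combination h - hN
  · by_cases h0 : (i : ℕ) = 0
    · obtain rfl : i = 0 := Fin.ext h0
      rw [quad_two_zero] at h
      exact absurd h (by simp)
    · rw [quad_two _ h0, Option.some_inj] at h
      have hy : y = x - 1 := by rw [← h]; ring
      rw [hy]
      rcases Nat.mod_two_eq_zero_or_one i with hpar | hpar
      · exact ⟨i, by omega, (faceBetween_even x hpar h0 (Or.inl rfl)).symm⟩
      · exact ⟨2 * k + 1 - i, by omega,
          (faceBetween_even x (by omega) (by omega) (by omega)).symm⟩
  · rw [quad_three, Option.some_inj] at h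
    have hle : (i : ℕ) ≤ 4 * k + 2 := by omega
    refine ⟨4 * k + 2 - i, by omega, ?_⟩
    rw [faceBetween_of_le x (i := i) (by omega) (by omega), Nat.cast_sub hle]
    refine Prod.ext ?_ rfl
    push_cast
    linear_combination h - hN

theorem neighbourOffset_lt {j : ℕ} (hj : j < 4 * k + 3) : neighbourOffset k j < 4 * k + 3 := by
  unfold neighbourOffset
  split_ifs <;> omega

theorem isRotation_some (x : ZMod (4 * k + 3)) :
    IsRotation (quad k) (some x) (4 * k + 3) (neighbour k x) (faceBetween k x) where
  three_le := by omega
  closed := by simp [neighbour]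
  injOn := by
    intro i hi j hj h
    rw [Set.mem_Iio] at hi hj
    unfold neighbour at h
    split_ifs at h with h1 h2 h2
    · omega
    · have := eq_of_natCast_eq (neighbourOffset_lt hi) (neighbourOffset_lt hj)
        (add_left_cancel (Option.some_injective _ h))
      unfold neighbourOffset at this
      split_ifs at this <;> omega
  corner := fun j hj => quad_faceBetween x hj
  exists_eq := exists_eq_faceBetween x

/-- The quadrangle (y, 0) joins y + 1 to y + 2k + 2 around ∞, a step of 2k + 1. This step is
invertible mod 4k + 3, with inverse −2, so the steps run through all residues in a single cycle. -/
theorem isRotation_none : IsRotation (quad k) none (4 * k + 3)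
    (fun j => some ((2 * k + 1) * j)) (fun j => ((2 * k + 1) * j - 1, 0)) where
  three_le := by omega
  closed := by
    push_cast
    rw [four_mul_add_three, mul_zero]
  injOn := by
    intro i hi j hj h
    refine eq_of_natCast_eq hi hj ?_
    have h := Option.some_injective _ h
    linear_combination (-2 : ZMod (4 * k + 3)) * h + (i - j) * four_mul_add_three
  corner := by
    intro j _
    refine ⟨2, quad_two_zero _, ?_⟩
    rw [show (2 + 1 : Fin 4) = 3 by rfl, show (2 + 3 : Fin 4) = 1 by rfl, quad_three, quad_one,
      Fin.val_zero]
    push_cast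
    congr 3 <;> ring
  exists_eq := by
    rintro ⟨y, i⟩ c h
    unfold quad at h
    split_ifs at h with hc
    obtain rfl : i = 0 := hc.2
    refine ⟨((y + 1) * (-2)).val, ZMod.val_lt _, Prod.ext ?_ rfl⟩
    rw [ZMod.natCast_val, ZMod.cast_id]
    linear_combination (y + 1) * four_mul_add_three

/-- `neighbourOffset` is an involution of the nonzero residues: on the odd numbers below 2k + 2 it
reflects r to 2k + 2 − r, which is again odd, and elsewhere it is the identity. -/
theorem exists_neighbour_eq (x z : ZMod (4 * k + 3)) (h : z ≠ x) :
    ∃ j < 4 * k + 3, neighbour k x j = some z := by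
  have hz : z = x + ((z - x).val : ZMod (4 * k + 3)) := by
    rw [ZMod.natCast_val, ZMod.cast_id]; ring
  have hlt : (z - x).val < 4 * k + 3 := ZMod.val_lt _
  have h0 : (z - x).val ≠ 0 := by
    rw [Ne, ZMod.val_eq_zero, sub_eq_zero]; exact h
  set r := (z - x).val
  refine ⟨neighbourOffset k r, neighbourOffset_lt hlt, ?_⟩
  have hinv : neighbourOffset k (neighbourOffset k r) = r := by
    unfold neighbourOffset
    split_ifs <;> omega
  have hne : neighbourOffset k r ≠ 0 := by
    unfold neighbourOffset
    split_ifs <;> omega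
  rw [neighbour, if_neg (by have := neighbourOffset_lt hlt; omega), hinv, ← hz]

theorem exists_quad_edge (u v : Option (ZMod (4 * k + 3))) (h : u ≠ v) :
    ∃ f c, s(quad k f c, quad k f (c + 1)) = s(u, v) := by
  have main : ∀ (x : ZMod (4 * k + 3)) (w : Option (ZMod (4 * k + 3))), w ≠ some x →
      ∃ f c, s(quad k f c, quad k f (c + 1)) = s(some x, w) := by
    intro x w hw
    obtain ⟨j, hj, rfl⟩ : ∃ j < 4 * k + 3, neighbour k x j = w := by
      rcases w with _ | z
      · exact ⟨0, by omega, by simp [neighbour]⟩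
      · exact exists_neighbour_eq x z fun h => hw (by rw [h])
    obtain ⟨c, hc, hu⟩ := quad_faceBetween x hj
    have e : c + 3 + 1 = c := by clear hc hu; revert c; decide
    rw [Sym2.eq_iff] at hu
    rcases hu with ⟨h1, -⟩ | ⟨-, h2⟩
    · exact ⟨_, c, by rw [hc, h1]⟩
    · exact ⟨_, c + 3, by rw [e, hc, h2, Sym2.eq_swap]⟩
  rcases u with _ | x
  · rcases v with _ | x
    · exact absurd rfl h
    · rw [Sym2.eq_swap]
      exact main x none (by simp)
  · exact main x v h.symm

variable (k) in
/-- A quadrangular embedding of the complete graph on `4k + 4` vertices. -/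
def completeQuadrangulation :
    CompleteQuadrangulation (Option (ZMod (4 * k + 3))) (ZMod (4 * k + 3) × Fin (k + 1)) where
  q := quad k
  injective := quad_injective
  exists_edge := exists_quad_edge
  exists_rotation v := by
    rcases v with _ | x
    · exact ⟨_, _, _, isRotation_none⟩
    · exact ⟨_, _, _, isRotation_some x⟩

/-- The quadrangle (j, k) has corners j, j + k + 2, j + 1, j + k + 1, so it lies between the sides
{j, j + k + 1} and {j + 1, j + k + 2}. Its other sides join j to j + k + 2 and j + k + 1 to j + 1,
whence the alternation with the parity of j. The number 4k + 3 of quadrangles is odd, so the two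
borders are exchanged at the end. -/
theorem isTwistedStrip_of_pos (hk : 0 < k) :
    (completeQuadrangulation k).IsTwistedStrip (4 * k + 3) (fun j => (j, Fin.last k))
      (fun j => some (j + if j % 2 = 1 then (k + 1 : ZMod (4 * k + 3)) else 0))
      (fun j => some (j + if j % 2 = 0 then (k + 1 : ZMod (4 * k + 3)) else 0)) where
  pos := by omega
  injOn i hi j hj h := eq_of_natCast_eq hi hj (congrArg Prod.fst h)
  quad := by
    intro j _
    have h2 : quad k ((j : ZMod (4 * k + 3)), Fin.last k) 2 = some ((j : ZMod (4 * k + 3)) + 1) :=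
      quad_two _ (by simpa using hk.ne')
    change ∃ c e : Fin 4, (e = 1 ∨ e = 3) ∧ quad k _ c = _ ∧ quad k _ (c + e) = _ ∧
      quad k _ (c + 2) = _ ∧ quad k _ (c + 3 * e) = _
    rcases Nat.mod_two_eq_zero_or_one j with hj | hj
    · refine ⟨0, 1, Or.inl rfl, ?_⟩
      have hj' : (j + 1) % 2 = 1 := by omega
      rw [show (0 + 1 : Fin 4) = 1 by rfl, show (0 + 2 : Fin 4) = 2 by rfl,
        show (0 + 3 * 1 : Fin 4) = 3 by rfl, h2, quad_zero, quad_one, quad_three]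
      simp only [hj, hj', if_true, Fin.val_last, Option.some_inj]
      norm_num
      ring
    · refine ⟨3, 3, Or.inr rfl, ?_⟩
      have hj' : (j + 1) % 2 = 0 := by omega
      rw [show (3 + 3 : Fin 4) = 2 by rfl, show (3 + 2 : Fin 4) = 1 by rfl,
        show (3 + 3 * 3 : Fin 4) = 0 by rfl, h2, quad_zero, quad_one, quad_three]
      simp only [hj, hj', if_true, Fin.val_last, Option.some_inj]
      norm_num
      ring
  edge := by
    intro i hi j hj h
    have hs : ∀ n : ℕ, s((some (n + if n % 2 = 1 then (k + 1 : ZMod (4 * k + 3)) else 0)),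
        some (n + if n % 2 = 0 then (k + 1 : ZMod (4 * k + 3)) else 0)) =
        s(some (n : ZMod (4 * k + 3)), some ((n : ZMod (4 * k + 3)) + (k + 1))) := by
      intro n
      rcases Nat.mod_two_eq_zero_or_one n with hn | hn
      · simp [hn]
      · simp [hn, Sym2.eq_swap]
    rw [hs, hs, Sym2.eq_iff] at h
    simp only [Option.some_inj] at h
    rcases h with ⟨h, -⟩ | ⟨h1, h2⟩
    · exact eq_of_natCast_eq hi hj h
    -- Matching the ends of two transversals crosswise would give 2(k + 1) = 0 mod 4k + 3.
    · have : ((2 * k + 2 : ℕ) : ZMod (4 * k + 3)) = (0 : ℕ) := by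
        push_cast
        linear_combination h2 - h1
      have := eq_of_natCast_eq (by omega) (by omega) this
      omega
  closed_b := by
    have h : (4 * k + 3) % 2 = 1 := by omega
    simp only [h, if_true]
    push_cast
    simp [four_mul_add_three]
  closed_t := by
    have h : (4 * k + 3) % 2 = 1 := by omega
    simp only [h]
    push_cast
    simp [four_mul_add_three]

/-- For k = 0 the only type is i = 0, whose corner 2 is ∞, so the previous strip is not available.
The quadrangles 0, 2, ∞, 1 and 1, 0, ∞, 2 share the sides {0, 1} and {2, ∞} and form a twisted strip
of length two. -/
theorem isTwistedStrip_zero :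
    (completeQuadrangulation 0).IsTwistedStrip 2 (fun j => ((j : ZMod 3), 0))
      (fun j => if j = 0 then some (0 : ZMod 3) else if j = 1 then some (2 : ZMod 3)
        else some (1 : ZMod 3))
      (fun j => if j = 0 then some (1 : ZMod 3) else if j = 1 then none
        else some (0 : ZMod 3)) where
  pos := by norm_num
  injOn i hi j hj h := by
    rw [Set.mem_Iio] at hi hj
    exact eq_of_natCast_eq (k := 0) (by omega) (by omega) (congrArg Prod.fst h)
  quad := by
    intro i hi
    interval_cases i
    · exact ⟨0, 1, Or.inl rfl, by decide⟩
    · exact ⟨3, 1, Or.inl rfl, by decide⟩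
  edge := by
    intro i hi j hj
    interval_cases i <;> interval_cases j <;> decide
  closed_b := by decide
  closed_t := by decide

variable (k) in
theorem exists_isTwistedStrip : ∃ m g b t, (completeQuadrangulation k).IsTwistedStrip m g b t := by
  rcases Nat.eq_zero_or_pos k with rfl | hk
  · exact ⟨_, _, _, _, isTwistedStrip_zero⟩
  · exact ⟨_, _, _, _, isTwistedStrip_of_pos hk⟩

end construction

namespace CompleteQuadrangulation

variable {V V' F : Type*}

/-- Renaming the vertices. -/
def map (Q : CompleteQuadrangulation V F) (e : V ≃ V') : CompleteQuadrangulation V' F where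
  q f c := e (Q.q f c)
  injective f := e.injective.comp (Q.injective f)
  exists_edge u v h := by
    obtain ⟨f, c, hfc⟩ := Q.exists_edge (e.symm u) (e.symm v) (e.symm.injective.ne h)
    exact ⟨f, c, by simpa using congrArg (Sym2.map e) hfc⟩
  exists_rotation v := by
    obtain ⟨d, u, φ, h⟩ := Q.exists_rotation (e.symm v)
    refine ⟨d, e ∘ u, φ, h.three_le, congrArg e h.closed, e.injective.comp_injOn h.injOn, ?_, ?_⟩
    · intro j hj
      obtain ⟨c, hc, hu⟩ := h.corner j hj
      exact ⟨c, e.eq_symm_apply.1 hc, by simpa using congrArg (Sym2.map e) hu⟩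
    · exact fun f c hc => h.exists_eq f c (e.eq_symm_apply.2 hc)

theorem IsTwistedStrip.map {Q : CompleteQuadrangulation V F} {m : ℕ} {g : ℕ → F} {b t : ℕ → V}
    (h : Q.IsTwistedStrip m g b t) (e : V ≃ V') :
    (Q.map e).IsTwistedStrip m g (e ∘ b) (e ∘ t) where
  pos := h.pos
  injOn := h.injOn
  quad i hi := by
    obtain ⟨c, d, hd, h1, h2, h3, h4⟩ := h.quad i hi
    exact ⟨c, d, hd, congrArg e h1, congrArg e h2, congrArg e h3, congrArg e h4⟩
  edge i hi j hj hij := h.edge i hi j hj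
    (Sym2.map.injective e.injective (by simpa using hij))
  closed_b := congrArg e h.closed_b
  closed_t := congrArg e h.closed_t

end CompleteQuadrangulation

theorem theorem1p4 (n : ℕ) (hpos : 0 < n) (hn : n ≡ 0 [MOD 4]) :
    ∃ (X : Type) (_ : TopologicalSpace X), IsSurface X ∧ IsNonorientable X ∧
      ∃ Φ : GraphEmbedding (SimpleGraph.completeGraph (Fin n)) X, Φ.IsQuadrangular := by
  obtain ⟨k, rfl⟩ : ∃ k, n = 4 * k + 4 := by
    obtain ⟨j, rfl⟩ := (Nat.modEq_zero_iff_dvd.1 hn)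
    exact ⟨j - 1, by omega⟩
  have e : Option (ZMod (4 * k + 3)) ≃ Fin (4 * k + 4) :=
    Fintype.equivFinOfCardEq (by rw [Fintype.card_option, ZMod.card])
  obtain ⟨m, g, b, t, h⟩ := exists_isTwistedStrip k
  let Q := (completeQuadrangulation k).map e
  exact ⟨Q.Surface, inferInstance, Q.isSurface, (h.map e).isNonorientable, Q.embedding,
    Q.isQuadrangular⟩
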